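/- All Hilbert spaces are finite-dimensional, $\log$ is the logarithm with base $2$ (with $\log 0=-\infty$), and real powers of a positive semidefinite operator are taken on its support. Write $\mathcal S(A)$ for the states on $A$. **Schumacher–Westmoreland (SW) decoder.** Let $\rho_A\in\mathcal S(A)$ and let $\mathcal N_{A\to B}$ be a quantum channel (a completely positive trace-preserving map). Put $d=\operatorname{rank}\rho_A$, let $\tilde R$ be a $d$-dimensional Hilbert space, and choose a purification of $\rho_A$ with Schmidt decomposition $|\rho\rangle_{\tilde RA}=\sum_{k<d}\sqrt{\lambda_k}\,|r_k\rangle\otimes|a_k\rangle$, where $(\lambda_k)$ is a probability distribution, $(|r_k\rangle)_{k<d}$ an orthonormal basis of $\tilde R$, and $(|a_k\rangle)_{k<d}$ orthonormal in $A$. Let $R',A',B'$ be copies of $\tilde R,A,B$, let $E=AB'$ and $E'=A'B\cong E$, let $V:A\to BE$ be an isometry with $\mathcal N(X)=\operatorname{tr}_E[VXV^\dagger]$ for all $X$, and let $|\sigma\rangle_{\tilde RBE}=V|\rho\rangle_{\tilde RA}$ with marginals $\sigma_{\tilde RE},\sigma_{\tilde R},\sigma_E$. Let $\sigma_E=\sum_l\mu_l|e_l\rangle\langle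 e_l|$ be a spectral decomposition with $(|e_l\rangle)$ an orthonormal basis of $E$, let $|\phi_{k,l}\rangle=|r_k\rangle\otimes|e_l\rangle$ (regarded as a basis of $\tilde RE$ and of $R'E'$), and set $|\Omega\rangle=\sum_{k,l}|\phi_{k,l}\rangle_{\tilde RE}\otimes|\phi_{k,l}\rangle_{R'E'}$, $|\Psi^\sigma\rangle=\sigma_{\tilde RE}^{1/2}|\Omega\rangle$ and $$M_{R'E'}=\sum_{k,j,m,n}\langle\phi_{k,m}|(\sigma_{\tilde R}\otimes\sigma_E)^{1/2}\sigma_{\tilde RE}^{1/2}|\phi_{j,n}\rangle\;|\phi_{j,n}\rangle\langle\phi_{k,m}|.$$ Choose a singular value decomposition $M=\hat U\Sigma\tilde U$ with $\hat U,\tilde U$ unitary and $\Sigma\ge0$ diagonal in the basis $(|\phi_{k,l}\rangle)$, put $U=\tilde U^\dagger\hat U^\dagger$, and choose a unit vector $|0\rangle\in R'A'$ and a unitary $W$ on $R'E'$ with $|\Psi^\sigma\rangle=W_{R'E'}(|\sigma\rangle_{\tilde RBE}\otimes|0\rangle_{R'A'})$. With $K_l=\sum_{k<d}|a_k\rangle\langle\phi_{k,l}|\,U\,W$,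 the SW decoder is $$\mathcal D^{\mathrm{SW}}_{B\to A}(X_B)=\sum_l K_l\,(X_B\otimes|0\rangle\langle0|_{R'A'})\,K_l^\dagger .$$ **Entanglement fidelity.** For a channel $\mathcal M_{A\to A}$, $F_e(\rho_A,\mathcal M)=\langle\rho|(\mathcal I_R\otimes\mathcal M)(|\rho\rangle\langle\rho|)|\rho\rangle$ for any purification $|\rho\rangle_{RA}$ of $\rho_A$ (the value does not depend on the purification). **Rényi mutual information.** For $\omega_{RB}\in\mathcal S(RB)$ and positive semidefinite $X_R$, let $I_2^\downarrow(\omega_{RB}\|X_R)=\inf_{\tau_B\in\mathcal S(B)}D_2(\omega_{RB}\|X_R\otimes\tau_B)$, where $D_2(\omega\|\tau)=\log\operatorname{tr}[\omega^2\tau^{-1}]$ if $\ker\tau\subseteq\ker\omega$, and $D_2(\omega\|\tau)=\infty$ otherwise. **Theorem.** Let $\rho_A\in\mathcal S(A)$, let $\mathcal N_{A\to B}$ be a quantum channel, and let $\mathcal D^{\mathrm{SW}}_{B\to A}$ be the SW decoder for $(\rho_A,\mathcal N_{A\to B})$ (for any admissible choices in its construction). Let $|\rho\rangle_{RA}$ be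 any purification of $\rho_A$, with $R$ of any finite dimension, and let $\sigma_{RB}=(\mathcal I_R\otimes\mathcal N_{A\to B})(|\rho\rangle\langle\rho|_{RA})$. Then $$\log F_e(\rho_A,\mathcal D^{\mathrm{SW}}_{B\to A}\circ\mathcal N_{A\to B})\;\ge\; I_2^\downarrow(\sigma_{RB}\|\sigma_R^{-1}).$$ -/

import Mathlib

open Matrix
open scoped Kronecker ComplexOrder

/-! Finite-dimensional Hilbert spaces are modelled as `ℂ^a` for a finite index type `a`; operators
are complex matrices, the tensor product of `ℂ^a` and `ℂ^b` is `ℂ^(a × b)`, and a vector of `ℂ^a`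
is a function `a → ℂ`. -/

namespace QInfo

noncomputable section

/-- The power `X ^ p` of a positive semidefinite matrix, taken on the support of `X`
(the eigenvalue `0` is mapped to `0` for every real `p`). -/
def psdPow {a : Type*} [Fintype a] [DecidableEq a] (X : Matrix a a ℂ) (p : ℝ) : Matrix a a ℂ :=
  cfc (fun x : ℝ => if x = 0 then 0 else x ^ p) X

/-- Quantum states. -/
def IsState {a : Type*} [Fintype a] (ρ : Matrix a a ℂ) : Prop :=
  ρ.PosSemidef ∧ ρ.trace = 1

/-- Kernel inclusion: `X ≪ Y` iff the kernel of `Y` is contained in the kernel of `X`. -/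
def Dominated {a : Type*} [Fintype a] (X Y : Matrix a a ℂ) : Prop :=
  ∀ v : a → ℂ, Y *ᵥ v = 0 → X *ᵥ v = 0

/-- Orthogonality of operators: `X Y = Y X = 0`. -/
def Orthog {a : Type*} [Fintype a] (X Y : Matrix a a ℂ) : Prop :=
  X * Y = 0 ∧ Y * X = 0

/-- Partial trace over the first tensor factor. -/
def trFst {a b : Type*} [Fintype a] (X : Matrix (a × b) (a × b) ℂ) : Matrix b b ℂ :=
  Matrix.of fun i j => ∑ k : a, X (k, i) (k, j)

/-- Partial trace over the second tensor factor. -/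
def trSnd {a b : Type*} [Fintype b] (X : Matrix (a × b) (a × b) ℂ) : Matrix a a ℂ :=
  Matrix.of fun i j => ∑ k : b, X (i, k) (j, k)

/-- The rank-one operator `|ψ⟩⟨φ|`. -/
def ketbra {a b : Type*} (ψ : a → ℂ) (φ : b → ℂ) : Matrix a b ℂ :=
  vecMulVec ψ (star φ)

/-- `|ψ⟩⟨ψ|`. -/
def proj {a : Type*} (ψ : a → ℂ) : Matrix a a ℂ := ketbra ψ ψ

/-- The tensor product `ψ ⊗ φ` of two vectors. -/
def tens {a b : Type*} (ψ : a → ℂ) (φ : b → ℂ) : a × b → ℂ := fun p => ψ p.1 * φ p.2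

/-- `|ψ⟩` on `RA` is a purification of `ρ` on `A`: `tr_R |ψ⟩⟨ψ| = ρ`. -/
def IsPurification {r a : Type*} [Fintype r] (ψ : r × a → ℂ) (ρ : Matrix a a ℂ) : Prop :=
  trFst (proj ψ) = ρ

/-- The map `id ⊗ N`, with the identity acting on the first tensor factor. -/
def idTensor (r : Type*) {a b : Type*} (N : Matrix a a ℂ →ₗ[ℂ] Matrix b b ℂ)
    (X : Matrix (r × a) (r × a) ℂ) : Matrix (r × b) (r × b) ℂ :=
  Matrix.of fun p q => N (Matrix.of fun x y => X (p.1, x) (q.1, y)) p.2 q.2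

/-- Quantum channels: completely positive and trace-preserving linear maps. -/
def IsChannel {a b : Type*} [Fintype a] [Fintype b]
    (N : Matrix a a ℂ →ₗ[ℂ] Matrix b b ℂ) : Prop :=
  (∀ (n : ℕ) (X : Matrix (Fin n × a) (Fin n × a) ℂ),
    X.PosSemidef → (idTensor (Fin n) N X).PosSemidef) ∧
  ∀ X : Matrix a a ℂ, (N X).trace = X.trace

/-- The base-2 logarithm of a nonnegative real, with `log 0 = -∞`. -/
def log2 (x : ℝ) : EReal := if 0 < x then ((Real.logb 2 x : ℝ) : EReal) else ⊥

open Classical in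
/-- The Petz Rényi divergence `D_α(ρ ‖ σ)`, for `α ∈ (0,1) ∪ (1,∞)`, of a state `ρ` relative to
a positive semidefinite `σ`. -/
def petzDiv {a : Type*} [Fintype a] [DecidableEq a] (α : ℝ) (ρ σ : Matrix a a ℂ) : EReal :=
  if (α < 1 ∧ ¬ Orthog ρ σ) ∨ Dominated ρ σ then
    ((1 / (α - 1) * Real.logb 2 (psdPow ρ α * psdPow σ (1 - α)).trace.re : ℝ) : EReal)
  else ⊤

/-- The minimized generalized Petz Rényi mutual information
`I_α^↓(ρ_{AB} ‖ σ_A) = inf_{τ_B} D_α(ρ_{AB} ‖ σ_A ⊗ τ_B)`, the infimum being over all states `τ_B`,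
for `α ∈ (0,1) ∪ (1,∞)`. -/
def petzMutualInfoDown {a b : Type*} [Fintype a] [DecidableEq a] [Fintype b] [DecidableEq b]
    (α : ℝ) (ρ : Matrix (a × b) (a × b) ℂ) (σ : Matrix a a ℂ) : EReal :=
  ⨅ τ : {τ : Matrix b b ℂ // IsState τ}, petzDiv α ρ (σ ⊗ₖ τ.1)

/-- The number `⟨ψ| (id_R ⊗ M)(|ψ⟩⟨ψ|) |ψ⟩`. -/
def purifiedFidelity {r a : Type*} [Fintype r] [Fintype a] (ψ : r × a → ℂ)
    (M : Matrix a a ℂ →ₗ[ℂ] Matrix a a ℂ) : ℝ :=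
  (star ψ ⬝ᵥ (idTensor r M (proj ψ) *ᵥ ψ)).re

/-- The purification `∑ᵢ |i⟩ ⊗ ρ^{1/2} |i⟩` of `ρ`. -/
def canonicalPurification {a : Type*} [Fintype a] [DecidableEq a] (ρ : Matrix a a ℂ) :
    a × a → ℂ :=
  fun p => psdPow ρ (1 / 2) p.2 p.1

/-- The entanglement fidelity `F_e(ρ, M) = ⟨ψ| (id_R ⊗ M)(|ψ⟩⟨ψ|) |ψ⟩`, where `ψ` is a purification
of `ρ`. By `entanglementFidelity_eq` below, every purification gives the same value. -/
def entanglementFidelity {a : Type*} [Fintype a] [DecidableEq a] (ρ : Matrix a a ℂ)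
    (M : Matrix a a ℂ →ₗ[ℂ] Matrix a a ℂ) : ℝ :=
  purifiedFidelity (canonicalPurification ρ) M

theorem isPurification_canonicalPurification {a : Type*} [Fintype a] [DecidableEq a]
    {ρ : Matrix a a ℂ} (hρ : ρ.PosSemidef) : IsPurification (canonicalPurification ρ) ρ := by
  have hsa : (psdPow ρ (1 / 2))ᴴ = psdPow ρ (1 / 2) :=
    (cfc_predicate (R := ℝ) (p := IsSelfAdjoint)
      (fun x : ℝ => if x = 0 then 0 else x ^ (1 / 2 : ℝ)) ρ : IsSelfAdjoint _)
  have hsq : psdPow ρ (1 / 2) * psdPow ρ (1 / 2) = ρ := by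
    unfold psdPow
    have hfin : (spectrum ℝ ρ).Finite := Matrix.finite_real_spectrum
    have hc : ∀ f : ℝ → ℝ, ContinuousOn f (spectrum ℝ ρ) := fun f => hfin.continuousOn f
    rw [← cfc_mul _ _ ρ (hc _) (hc _)]
    conv_rhs => rw [← cfc_id ℝ ρ hρ.1.isSelfAdjoint]
    apply cfc_congr
    intro x hx
    have hx0 : 0 ≤ x := by
      rw [hρ.1.spectrum_real_eq_range_eigenvalues] at hx
      obtain ⟨i, rfl⟩ := hx
      exact hρ.eigenvalues_nonneg i
    by_cases h : x = 0
    · simp [h]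
    · have hp : 0 < x := lt_of_le_of_ne hx0 (Ne.symm h)
      simp only [h, if_false, id]
      rw [← Real.rpow_add hp]
      norm_num
  unfold IsPurification
  ext i j
  have := congrFun (congrFun hsq i) j
  rw [← this]
  conv_rhs => rw [← hsa]
  nth_rewrite 1 [hsa]
  simp [trFst, proj, ketbra, vecMulVec_apply, canonicalPurification, Matrix.mul_apply]

theorem purifiedFidelity_eq_sum {r a : Type*} [Fintype r] [Fintype a] [DecidableEq a]
    {ψ : r × a → ℂ} {ρ : Matrix a a ℂ} (hψ : IsPurification ψ ρ)
    (M : Matrix a a ℂ →ₗ[ℂ] Matrix a a ℂ) :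
    purifiedFidelity ψ M = (∑ j, ∑ j', ∑ x, ∑ y,
      M (Matrix.single x y 1) j j' * (ρ x j * ρ j' y)).re := by
  have hρ : ∀ x y, ρ x y = ∑ i, ψ (i, x) * star (ψ (i, y)) := by
    intro x y
    rw [← hψ]
    simp [trFst, proj, ketbra, vecMulVec_apply]
  have hM : ∀ X : Matrix a a ℂ, ∀ j j',
      M X j j' = ∑ x, ∑ y, X x y * M (Matrix.single x y 1) j j' := by
    intro X j j'
    conv_lhs => rw [Matrix.matrix_eq_sum_single X]
    simp only [map_sum, Matrix.sum_apply]
    refine Finset.sum_congr rfl fun x _ => Finset.sum_congr rfl fun y _ => ?_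
    have : Matrix.single x y (X x y) = X x y • Matrix.single x y (1 : ℂ) := by
      simp
    rw [this, map_smul]
    simp
  unfold purifiedFidelity
  congr 1
  have h1 : star ψ ⬝ᵥ (idTensor r M (proj ψ) *ᵥ ψ) =
      ∑ i, ∑ j, ∑ i', ∑ j', ∑ x, ∑ y,
        M (Matrix.single x y 1) j j' *
          ((ψ (i, x) * star (ψ (i, j))) * (ψ (i', j') * star (ψ (i', y)))) := by
    simp only [dotProduct, Matrix.mulVec, Fintype.sum_prod_type, idTensor, Matrix.of_apply]
    refine Finset.sum_congr rfl fun i _ => Finset.sum_congr rfl fun j _ => ?_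
    rw [Finset.mul_sum]
    refine Finset.sum_congr rfl fun i' _ => ?_
    rw [Finset.mul_sum]
    refine Finset.sum_congr rfl fun j' _ => ?_
    rw [hM, Finset.sum_mul, Finset.mul_sum]
    refine Finset.sum_congr rfl fun x _ => ?_
    rw [Finset.sum_mul, Finset.mul_sum]
    refine Finset.sum_congr rfl fun y _ => ?_
    simp only [proj, ketbra, vecMulVec_apply, Pi.star_apply, Matrix.of_apply]
    ring
  rw [h1, Finset.sum_comm]
  refine Finset.sum_congr rfl fun j _ => ?_
  have h2 : ∀ i : r, (∑ i', ∑ j', ∑ x, ∑ y, M (Matrix.single x y 1) j j' *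
      ((ψ (i, x) * star (ψ (i, j))) * (ψ (i', j') * star (ψ (i', y))))) =
      ∑ j', ∑ x, ∑ y, M (Matrix.single x y 1) j j' *
        ((ψ (i, x) * star (ψ (i, j))) * ρ j' y) := by
    intro i
    rw [Finset.sum_comm]
    refine Finset.sum_congr rfl fun j' _ => ?_
    rw [Finset.sum_comm]
    refine Finset.sum_congr rfl fun x _ => ?_
    rw [Finset.sum_comm]
    refine Finset.sum_congr rfl fun y _ => ?_
    rw [hρ j' y, Finset.mul_sum, Finset.mul_sum]
  simp only [h2]
  rw [Finset.sum_comm]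
  refine Finset.sum_congr rfl fun j' _ => ?_
  rw [Finset.sum_comm]
  refine Finset.sum_congr rfl fun x _ => ?_
  rw [Finset.sum_comm]
  refine Finset.sum_congr rfl fun y _ => ?_
  rw [hρ x j, Finset.sum_mul, Finset.mul_sum]

/-- The entanglement fidelity does not depend on the choice of the purification. -/
theorem entanglementFidelity_eq {r a : Type*} [Fintype r] [Fintype a] [DecidableEq a]
    {ψ : r × a → ℂ} {ρ : Matrix a a ℂ} (hρ : ρ.PosSemidef) (hψ : IsPurification ψ ρ)
    (M : Matrix a a ℂ →ₗ[ℂ] Matrix a a ℂ) :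
    entanglementFidelity ρ M = purifiedFidelity ψ M := by
  rw [entanglementFidelity, purifiedFidelity_eq_sum hψ,
    purifiedFidelity_eq_sum (isPurification_canonicalPurification hρ)]

/-! ### The Schumacher–Westmoreland decoder

Throughout, `R = ℂ^d`, `E = A ⊗ B'` and `E' = A' ⊗ B` with `A'` a copy of `A` and `B'` a copy of
`B`, so that `E` and `E'` are both indexed by `a × b`. -/

/-- First group of choices: a Schmidt decomposition `∑ₖ √λₖ |rₖ⟩ ⊗ |aₖ⟩` of a purification of `ρ`
on `RA` with `dim R = d`, a Stinespring isometry `V : A → B ⊗ E` of `N`, a spectral decomposition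
`∑ₗ μₗ |eₗ⟩⟨eₗ|` of the marginal on `E` of `V |ρ⟩`, and a unit vector `|0⟩` of `R'A'`.
Of the basis `(aₖ)` of `A` only the members with `k < d` are recorded, and the basis of `E` is
indexed by the index set `a × b` of `E`. -/
structure SWBase {a b : Type*} [Fintype a] [DecidableEq a] [Fintype b] [DecidableEq b] (d : ℕ)
    (ρ : Matrix a a ℂ) (N : Matrix a a ℂ →ₗ[ℂ] Matrix b b ℂ) where
  /-- Schmidt coefficients (squared). -/
  lam : Fin d → ℝ
  lam_nonneg : ∀ k, 0 ≤ lam k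
  lam_sum : ∑ k, lam k = 1
  /-- The orthonormal basis of `R`. -/
  rb : OrthonormalBasis (Fin d) ℂ (EuclideanSpace ℂ (Fin d))
  /-- The orthonormal vectors of `A`. -/
  av : Fin d → EuclideanSpace ℂ a
  av_orthonormal : Orthonormal ℂ av
  schmidt : IsPurification
    (∑ k, ((Real.sqrt (lam k) : ℝ) : ℂ) • tens (fun i => rb k i) (fun x => av k x)) ρ
  /-- The Stinespring isometry. -/
  V : Matrix (b × (a × b)) a ℂ
  V_isometry : Vᴴ * V = 1
  stinespring : ∀ X : Matrix a a ℂ, N X = trSnd (V * X * Vᴴ)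
  /-- Spectrum of the marginal on `E`. -/
  mu : a × b → ℝ
  mu_nonneg : ∀ l, 0 ≤ mu l
  mu_sum : ∑ l, mu l = 1
  /-- The orthonormal eigenbasis of `E`. -/
  eb : OrthonormalBasis (a × b) ℂ (EuclideanSpace ℂ (a × b))
  spectral : trFst (V * ρ * Vᴴ) = ∑ l, ((mu l : ℝ) : ℂ) • proj (fun e => eb l e)
  /-- The vector `|0⟩` of `R'A'`. -/
  zeroVec : EuclideanSpace ℂ (Fin d × a)
  zeroVec_norm : ‖zeroVec‖ = 1

namespace SWBase

variable {a b : Type*} [Fintype a] [DecidableEq a] [Fintype b] [DecidableEq b] {d : ℕ}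
  {ρ : Matrix a a ℂ} {N : Matrix a a ℂ →ₗ[ℂ] Matrix b b ℂ} (S : SWBase d ρ N)

/-- The purification `|ρ⟩` of `ρ` on `RA`. -/
def ketRho : Fin d × a → ℂ :=
  ∑ k, ((Real.sqrt (S.lam k) : ℝ) : ℂ) • tens (fun i => S.rb k i) (fun x => S.av k x)

/-- `|σ⟩ = V |ρ⟩` on `RBE`. -/
def ketSigma : Fin d × (b × (a × b)) → ℂ :=
  ((1 : Matrix (Fin d) (Fin d) ℂ) ⊗ₖ S.V) *ᵥ S.ketRho

/-- The marginal of `|σ⟩⟨σ|` on `RE`. -/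
def sigmaRE : Matrix (Fin d × (a × b)) (Fin d × (a × b)) ℂ :=
  Matrix.of fun p q =>
    ∑ y : b, S.ketSigma (p.1, (y, p.2)) * star (S.ketSigma (q.1, (y, q.2)))

/-- `σ_R ⊗ σ_E`. -/
def sigmaHat : Matrix (Fin d × (a × b)) (Fin d × (a × b)) ℂ :=
  trSnd S.sigmaRE ⊗ₖ trFst S.sigmaRE

/-- The product basis vectors `|rₖ⟩ ⊗ |eₗ⟩`, of `RE` as well as of `R'E'`. -/
def phi (p : Fin d × (a × b)) : Fin d × (a × b) → ℂ :=
  tens (fun i => S.rb p.1 i) (fun e => S.eb p.2 e)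

/-- `|Ω⟩` on `RE ⊗ R'E'`. -/
def Omega : (Fin d × (a × b)) × (Fin d × (a × b)) → ℂ :=
  ∑ p : Fin d × (a × b), tens (S.phi p) (S.phi p)

/-- `|Ψ^σ⟩ = σ_{RE}^{1/2} |Ω⟩`. -/
def PsiSigma : (Fin d × (a × b)) × (Fin d × (a × b)) → ℂ :=
  (psdPow S.sigmaRE (1 / 2) ⊗ₖ (1 : Matrix (Fin d × (a × b)) (Fin d × (a × b)) ℂ)) *ᵥ S.Omega

/-- The operator `M` on `R'E'`: the sum over `p = (k, m)` and `q = (j, n)` of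
`⟨rₖ eₘ| (σ_R ⊗ σ_E)^{1/2} σ_{RE}^{1/2} |rⱼ eₙ⟩ |rⱼ eₙ⟩⟨rₖ eₘ|`. -/
def M : Matrix (Fin d × (a × b)) (Fin d × (a × b)) ℂ :=
  ∑ p : Fin d × (a × b), ∑ q : Fin d × (a × b),
    (star (S.phi p) ⬝ᵥ ((psdPow S.sigmaHat (1 / 2) * psdPow S.sigmaRE (1 / 2)) *ᵥ S.phi q)) •
      ketbra (S.phi q) (S.phi p)

/-- The vector `|σ⟩_{RBE} ⊗ |0⟩_{R'A'}`, regarded as a vector of `RE ⊗ R'E'` with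
`E' = A' ⊗ B`. -/
def ketSigmaZero : (Fin d × (a × b)) × (Fin d × (a × b)) → ℂ :=
  fun p => S.ketSigma (p.1.1, (p.2.2.2, p.1.2)) * S.zeroVec (p.2.1, p.2.2.1)

/-- `X_B ↦ X_B ⊗ |0⟩⟨0|_{R'A'}`, from `B` to `R'E'`. -/
def appendZero (X : Matrix b b ℂ) : Matrix (Fin d × (a × b)) (Fin d × (a × b)) ℂ :=
  Matrix.of fun p q =>
    X p.2.2 q.2.2 * (S.zeroVec (p.1, p.2.1) * star (S.zeroVec (q.1, q.2.1)))

end SWBase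

/-- All choices made in the construction of the decoder: in addition to those of `SWBase`, a
singular value decomposition `M = Uhat * Sig * Util` with `Sig` positive semidefinite and diagonal
in the basis `|rₖ⟩ ⊗ |eₗ⟩`, and a unitary `W` on `R'E'` with `|Ψ^σ⟩ = W (|σ⟩ ⊗ |0⟩)`. -/
structure SWConstruction {a b : Type*} [Fintype a] [DecidableEq a] [Fintype b] [DecidableEq b]
    (d : ℕ) (ρ : Matrix a a ℂ) (N : Matrix a a ℂ →ₗ[ℂ] Matrix b b ℂ) extends SWBase d ρ N where
  Uhat : Matrix (Fin d × (a × b)) (Fin d × (a × b)) ℂ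
  Uhat_unitary : Uhat ∈ Matrix.unitaryGroup (Fin d × (a × b)) ℂ
  Util : Matrix (Fin d × (a × b)) (Fin d × (a × b)) ℂ
  Util_unitary : Util ∈ Matrix.unitaryGroup (Fin d × (a × b)) ℂ
  /-- Singular values. -/
  sv : Fin d × (a × b) → ℝ
  sv_nonneg : ∀ p, 0 ≤ sv p
  svd : toSWBase.M =
    Uhat * (∑ p : Fin d × (a × b), ((sv p : ℝ) : ℂ) • proj (toSWBase.phi p)) * Util
  W : Matrix (Fin d × (a × b)) (Fin d × (a × b)) ℂ
  W_unitary : W ∈ Matrix.unitaryGroup (Fin d × (a × b)) ℂ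
  W_spec : toSWBase.PsiSigma =
    ((1 : Matrix (Fin d × (a × b)) (Fin d × (a × b)) ℂ) ⊗ₖ W) *ᵥ toSWBase.ketSigmaZero

namespace SWConstruction

variable {a b : Type*} [Fintype a] [DecidableEq a] [Fintype b] [DecidableEq b] {d : ℕ}
  {ρ : Matrix a a ℂ} {N : Matrix a a ℂ →ₗ[ℂ] Matrix b b ℂ} (S : SWConstruction d ρ N)

/-- `U = Util† Uhat†`. -/
def U : Matrix (Fin d × (a × b)) (Fin d × (a × b)) ℂ := S.Utilᴴ * S.Uhatᴴ

/-- The Kraus operators `K_l = ∑ₖ |aₖ⟩⟨rₖ eₗ| U W`. -/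
def K (l : a × b) : Matrix a (Fin d × (a × b)) ℂ :=
  (∑ k : Fin d, ketbra (fun x => S.av k x) (S.phi (k, l))) * S.U * S.W

/-- The decoder `X_B ↦ ∑ₗ K_l (X_B ⊗ |0⟩⟨0|) K_l†`. -/
def decoder : Matrix b b ℂ →ₗ[ℂ] Matrix a a ℂ where
  toFun X := ∑ l : a × b, S.K l * S.appendZero X * (S.K l)ᴴ
  map_add' X Y := by
    rw [← Finset.sum_add_distrib]
    refine Finset.sum_congr rfl fun l _ => ?_
    have : S.appendZero (X + Y) = S.appendZero X + S.appendZero Y := by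
      ext p q
      simp [SWBase.appendZero, add_mul]
    rw [this, Matrix.mul_add, Matrix.add_mul]
  map_smul' c X := by
    rw [RingHom.id_apply, Finset.smul_sum]
    refine Finset.sum_congr rfl fun l _ => ?_
    have : S.appendZero (c • X) = c • S.appendZero X := by
      ext p q
      simp [SWBase.appendZero, mul_assoc]
    rw [this, Matrix.mul_smul, Matrix.smul_mul]

end SWConstruction

/-- `D` is a Schumacher–Westmoreland decoder for `(ρ, N)`: it arises from the construction, with
`dim R = rank ρ`, for some admissible choice of all the auxiliary objects. -/
def IsSWDecoder {a b : Type*} [Fintype a] [DecidableEq a] [Fintype b] [DecidableEq b]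
    (ρ : Matrix a a ℂ) (N : Matrix a a ℂ →ₗ[ℂ] Matrix b b ℂ)
    (D : Matrix b b ℂ →ₗ[ℂ] Matrix a a ℂ) : Prop :=
  ∃ S : SWConstruction ρ.rank ρ N, D = S.decoder

end

end QInfo

/-! Both sides are compared with one operator on B, Z = tr_R[σ_RB² (σ_R ⊗ 1)] (`tiltedMarginal`),
through the number c = tr Z^{1/2}.

Mutual information. Inverting σ_R^{-1} on its support gives σ_R back, so for admissible τ the
divergence D_2(σ_RB ‖ σ_R^{-1} ⊗ τ) equals log tr[Z τ^{-1}]. The choice τ = Z^{1/2}/c gives log c²,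
hence I_2^↓ ≤ log c² (`petzMutualInfoDown_two_le`). That this τ is admissible rests on σ_RB being
supported on supp σ_R ⊗ supp Z (`mul_support_eq_self`).

Link to the decoder. If S is the coefficient matrix of |σ⟩ across the cut RE|B, then SS† = σ_RE and
Zᵀ = S†(σ_R ⊗ σ_E)S. Since XY and YX have the same nonzero spectrum, Z and MM† share their nonzero
eigenvalues, so c is the sum of the singular values of M (`sum_sv`), which is tr(MU) for the
decoder's U.

Fidelity. The entanglement fidelity is a sum of |⟨ρ|ζ⟩|² over branches ζ, indexed by the Kraus index
l and a basis of the discarded system E. Cauchy–Schwarz against the eigenvector e_l in E, and then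
against the weights √μ_l, bounds this sum below by |tr(MU)|² = c² (`sq_sum_sv_le_purifiedFidelity`).

Z depends on the purification only through ρ (`tiltedMarginal_block_apply`), so the reference system
in the mutual information need not be the one used by the decoder. -/

namespace QInfo

/-! ### Powers of positive semidefinite matrices and traces of square roots -/

section LinearAlgebra

variable {n m : Type*} [Fintype n] [DecidableEq n] [Fintype m] [DecidableEq m]

/-- The functional calculus of a unitarily diagonalised Hermitian matrix. -/
theorem cfc_conj_diagonal {U : Matrix n n ℂ} (hU : U ∈ Matrix.unitaryGroup n ℂ) (d : n → ℝ)
    (f : ℝ → ℝ) :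
    cfc f (U * diagonal (fun i => (d i : ℂ)) * Uᴴ) =
      U * diagonal (fun i => (f (d i) : ℂ)) * Uᴴ := by
  have hUl : Uᴴ * U = 1 := Matrix.mem_unitaryGroup_iff'.1 hU
  have hUr : U * Uᴴ = 1 := Matrix.mem_unitaryGroup_iff.1 hU
  set A := U * diagonal (fun i => (d i : ℂ)) * Uᴴ with hAdef
  have hA : A.IsHermitian := by
    rw [hAdef]
    apply Matrix.isHermitian_mul_mul_conjTranspose
    rw [Matrix.isHermitian_diagonal_iff]
    intro i
    exact Complex.conj_ofReal _
  rw [hA.cfc_eq f, IsHermitian.cfc, Unitary.conjStarAlgAut_apply]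
  have hsp := hA.spectral_theorem
  rw [Unitary.conjStarAlgAut_apply] at hsp
  set W : Matrix n n ℂ := (hA.eigenvectorUnitary : Matrix n n ℂ) with hW
  have hWl : Wᴴ * W = 1 := Matrix.mem_unitaryGroup_iff'.1 hA.eigenvectorUnitary.2
  have hWr : W * Wᴴ = 1 := Matrix.mem_unitaryGroup_iff.1 hA.eigenvectorUnitary.2
  rw [Matrix.star_eq_conjTranspose] at hsp ⊢
  have key : diagonal (fun i => (d i : ℂ)) * (Uᴴ * W) =
      (Uᴴ * W) * diagonal (RCLike.ofReal ∘ hA.eigenvalues) := by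
    calc diagonal (fun i => (d i : ℂ)) * (Uᴴ * W) = Uᴴ * A * W := by
          rw [hAdef]
          simp only [Matrix.mul_assoc]
          rw [← Matrix.mul_assoc Uᴴ U, hUl, Matrix.one_mul]
      _ = _ := by
          have h : A * W = W * diagonal (RCLike.ofReal ∘ hA.eigenvalues) := by
            conv_lhs => rw [hsp]
            rw [Matrix.mul_assoc, hWl, Matrix.mul_one]
          rw [Matrix.mul_assoc, h, Matrix.mul_assoc]
  -- An entry (i, j) of the intertwiner UᴴW can be nonzero only if the i-th and j-th eigenvalues of
  -- the two diagonalisations agree; hence it also intertwines their images under f.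
  have key2 : diagonal (fun i => (f (d i) : ℂ)) * (Uᴴ * W) =
      (Uᴴ * W) * diagonal (RCLike.ofReal ∘ f ∘ hA.eigenvalues) := by
    ext i j
    have h := congrFun (congrFun key i) j
    rw [Matrix.diagonal_mul, Matrix.mul_diagonal] at h ⊢
    by_cases h0 : (Uᴴ * W) i j = 0
    · simp [h0]
    · rw [mul_comm] at h
      have h1 := mul_left_cancel₀ h0 h
      have h2 : d i = hA.eigenvalues j := by
        have : ((d i : ℝ) : ℂ) = ((hA.eigenvalues j : ℝ) : ℂ) := h1
        exact_mod_cast this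
      simp [h2, mul_comm]
  calc W * diagonal (RCLike.ofReal ∘ f ∘ hA.eigenvalues) * Wᴴ
      = U * ((Uᴴ * W) * diagonal (RCLike.ofReal ∘ f ∘ hA.eigenvalues)) * Wᴴ := by
        simp only [← Matrix.mul_assoc]
        rw [hUr, Matrix.one_mul]
    _ = _ := by
        rw [← key2]
        simp only [Matrix.mul_assoc, hWr, Matrix.mul_one]

theorem psdPow_conj_diagonal {U : Matrix n n ℂ} (hU : U ∈ Matrix.unitaryGroup n ℂ) (d : n → ℝ)
    (p : ℝ) :
    psdPow (U * diagonal (fun i => (d i : ℂ)) * Uᴴ) p =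
      U * diagonal (fun i => ((if d i = 0 then 0 else d i ^ p : ℝ) : ℂ)) * Uᴴ :=
  cfc_conj_diagonal hU d _

theorem exists_conj_diagonal {H : Matrix n n ℂ} (hH : H.PosSemidef) :
    ∃ U ∈ Matrix.unitaryGroup n ℂ, ∃ d : n → ℝ, (∀ i, 0 ≤ d i) ∧
      H = U * diagonal (fun i => (d i : ℂ)) * Uᴴ := by
  refine ⟨hH.1.eigenvectorUnitary, hH.1.eigenvectorUnitary.2, hH.1.eigenvalues,
    hH.eigenvalues_nonneg, ?_⟩
  have hsp := hH.1.spectral_theorem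
  rw [Unitary.conjStarAlgAut_apply] at hsp
  exact hsp

theorem conj_diagonal_mul {U : Matrix n n ℂ} (hU : U ∈ Matrix.unitaryGroup n ℂ) (d e : n → ℂ) :
    (U * diagonal d * Uᴴ) * (U * diagonal e * Uᴴ) = U * diagonal (fun i => d i * e i) * Uᴴ := by
  have hUl : Uᴴ * U = 1 := Matrix.mem_unitaryGroup_iff'.1 hU
  rw [← Matrix.diagonal_mul_diagonal]
  simp only [Matrix.mul_assoc]
  rw [← Matrix.mul_assoc Uᴴ U, hUl, Matrix.one_mul]

theorem trace_conj_diagonal {U : Matrix n n ℂ} (hU : U ∈ Matrix.unitaryGroup n ℂ) (d : n → ℂ) :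
    (U * diagonal d * Uᴴ).trace = ∑ i, d i := by
  have hUl : Uᴴ * U = 1 := Matrix.mem_unitaryGroup_iff'.1 hU
  rw [Matrix.trace_mul_comm, ← Matrix.mul_assoc, hUl, Matrix.one_mul, Matrix.trace_diagonal]

theorem conj_diagonal_posSemidef (U : Matrix n n ℂ) {d : n → ℝ} (hd : ∀ i, 0 ≤ d i) :
    (U * diagonal (fun i => (d i : ℂ)) * Uᴴ).PosSemidef := by
  apply Matrix.PosSemidef.mul_mul_conjTranspose_same
  exact Matrix.PosSemidef.diagonal fun i => by simpa using hd i

theorem conj_diagonal_isHermitian (U : Matrix n n ℂ) (d : n → ℝ) :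
    (U * diagonal (fun i => (d i : ℂ)) * Uᴴ)ᴴ = U * diagonal (fun i => (d i : ℂ)) * Uᴴ := by
  rw [Matrix.conjTranspose_mul, Matrix.conjTranspose_mul, Matrix.conjTranspose_conjTranspose,
    Matrix.diagonal_conjTranspose, Matrix.mul_assoc]
  congr 3
  ext i
  simp

theorem conj_diagonal_kronecker (U : Matrix n n ℂ) (U' : Matrix m m ℂ) (d : n → ℂ) (e : m → ℂ) :
    (U * diagonal d * Uᴴ) ⊗ₖ (U' * diagonal e * U'ᴴ) =
      (U ⊗ₖ U') * diagonal (fun p : n × m => d p.1 * e p.2) * (U ⊗ₖ U')ᴴ := by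
  rw [← Matrix.diagonal_kronecker_diagonal, Matrix.conjTranspose_kronecker,
    Matrix.mul_kronecker_mul, Matrix.mul_kronecker_mul]

theorem psdPow_kronecker {X : Matrix n n ℂ} {Y : Matrix m m ℂ} (hX : X.PosSemidef)
    (hY : Y.PosSemidef) (p : ℝ) : psdPow (X ⊗ₖ Y) p = psdPow X p ⊗ₖ psdPow Y p := by
  obtain ⟨U, hU, d, hd, rfl⟩ := exists_conj_diagonal hX
  obtain ⟨U', hU', e, he, rfl⟩ := exists_conj_diagonal hY
  rw [psdPow_conj_diagonal hU, psdPow_conj_diagonal hU', conj_diagonal_kronecker,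
    conj_diagonal_kronecker]
  have h : (fun q : n × m => (d q.1 : ℂ) * (e q.2 : ℂ)) =
      fun q : n × m => ((d q.1 * e q.2 : ℝ) : ℂ) := by
    ext; simp
  rw [h, psdPow_conj_diagonal (Matrix.kronecker_mem_unitary hU hU')]
  congr 3
  ext q
  by_cases h1 : d q.1 = 0
  · simp [h1]
  by_cases h2 : e q.2 = 0
  · simp [h2]
  simp only [mul_eq_zero, h1, h2, or_self, if_false]
  rw [Real.mul_rpow (hd _) (he _)]
  push_cast
  rfl

theorem psdPow_half_isHermitian {H : Matrix n n ℂ} (hH : H.PosSemidef) :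
    (psdPow H (1 / 2))ᴴ = psdPow H (1 / 2) := by
  obtain ⟨U, hU, d, hd, rfl⟩ := exists_conj_diagonal hH
  rw [psdPow_conj_diagonal hU, conj_diagonal_isHermitian]

theorem psdPow_half_mul_self {H : Matrix n n ℂ} (hH : H.PosSemidef) :
    psdPow H (1 / 2) * psdPow H (1 / 2) = H := by
  obtain ⟨U, hU, d, hd, rfl⟩ := exists_conj_diagonal hH
  rw [psdPow_conj_diagonal hU, conj_diagonal_mul hU]
  congr 3
  ext i
  by_cases h : d i = 0
  · simp [h]
  · simp only [h, if_false]
    rw [← Complex.ofReal_mul, ← Real.rpow_add (lt_of_le_of_ne (hd i) (Ne.symm h))]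
    norm_num

theorem psdPow_two {H : Matrix n n ℂ} (hH : H.PosSemidef) : psdPow H 2 = H * H := by
  obtain ⟨U, hU, d, hd, rfl⟩ := exists_conj_diagonal hH
  rw [psdPow_conj_diagonal hU, conj_diagonal_mul hU]
  congr 3
  ext i
  by_cases h : d i = 0
  · simp [h]
  · simp only [h, if_false]
    norm_cast
    ring

/-- The sum of the square roots of the roots of a polynomial. -/
noncomputable def sqrtRootSum (p : Polynomial ℂ) : ℝ :=
  (p.roots.map fun z => Real.sqrt z.re).sum

theorem sqrtRootSum_X_pow_mul (k : ℕ) {p : Polynomial ℂ} (hp : p ≠ 0) :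
    sqrtRootSum (Polynomial.X ^ k * p) = sqrtRootSum p := by
  unfold sqrtRootSum
  rw [Polynomial.roots_mul (mul_ne_zero (pow_ne_zero _ Polynomial.X_ne_zero) hp),
    Polynomial.roots_X_pow]
  simp [Multiset.map_nsmul, Multiset.sum_nsmul]

/-- The two characteristic polynomials differ only by powers of X, and a root 0 contributes √0 = 0.
Working with roots rather than operator square roots allows the two products to have different sizes
and to be non-Hermitian. -/
theorem sqrtRootSum_charpoly_mul_comm (A : Matrix n m ℂ) (B : Matrix m n ℂ) :
    sqrtRootSum (A * B).charpoly = sqrtRootSum (B * A).charpoly := by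
  rw [← sqrtRootSum_X_pow_mul (Fintype.card m) (Matrix.charpoly_monic (A * B)).ne_zero,
    Matrix.charpoly_mul_comm', sqrtRootSum_X_pow_mul _ (Matrix.charpoly_monic (B * A)).ne_zero]

theorem sqrtRootSum_charpoly_conj_diagonal {U : Matrix n n ℂ}
    (hU : U ∈ Matrix.unitaryGroup n ℂ) (d : n → ℝ) :
    sqrtRootSum (U * diagonal (fun i => (d i : ℂ)) * Uᴴ).charpoly = ∑ i, Real.sqrt (d i) := by
  have hUl : Uᴴ * U = 1 := Matrix.mem_unitaryGroup_iff'.1 hU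
  rw [Matrix.charpoly_mul_comm, ← Matrix.mul_assoc, hUl, Matrix.one_mul,
    Matrix.charpoly_diagonal, sqrtRootSum]
  have h : ∏ i, (Polynomial.X - Polynomial.C (d i : ℂ)) =
      ((Finset.univ.val.map fun i => (d i : ℂ)).map
        fun z => Polynomial.X - Polynomial.C z).prod := by
    rw [Multiset.map_map]
    rfl
  rw [h, Polynomial.roots_multiset_prod_X_sub_C]
  rw [Multiset.map_map]
  rfl

end LinearAlgebra

/-! ### Channel outputs in block form and the operator Z -/

section Blocks

variable {r a b e : Type*}

/-- The block `T_y`, with entries `⟨i, e| T_y = ∑ₓ ψ(i,x) V((y,e),x)`, of `(1 ⊗ V) |ψ⟩`. -/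
def block [Fintype a] (ψ : r × a → ℂ) (V : Matrix (b × e) a ℂ) (y : b) : Matrix r e ℂ :=
  (Matrix.of fun i x => ψ (i, x)) * (Matrix.of fun f x => V (y, f) x)ᵀ

/-- The matrix on `RB` with blocks `T_y T_z†`. -/
def blockState [Fintype e] (T : b → Matrix r e ℂ) : Matrix (r × b) (r × b) ℂ :=
  Matrix.of fun p q => (T p.2 * (T q.2)ᴴ) p.1 q.1

theorem idTensor_proj_eq_blockState [Fintype a] [Fintype e] (ψ : r × a → ℂ) (V : Matrix (b × e) a ℂ)
    {N : Matrix a a ℂ →ₗ[ℂ] Matrix b b ℂ} (hN : ∀ X, N X = trSnd (V * X * Vᴴ)) :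
    idTensor r N (proj ψ) = blockState (block ψ V) := by
  ext p q
  simp only [idTensor, hN, blockState, block, trSnd, Matrix.of_apply]
  have h : (Matrix.of fun x y => proj ψ (p.1, x) (q.1, y)) =
      vecMulVec (fun x => ψ (p.1, x)) (star fun x => ψ (q.1, x)) := by
    ext x y
    simp [proj, ketbra, vecMulVec_apply]
  rw [h]
  simp only [Matrix.mul_vecMulVec, Matrix.vecMulVec_mul, vecMulVec_apply]
  rw [Matrix.mul_apply]
  refine Finset.sum_congr rfl fun f _ => ?_
  congr 1
  · simp [Matrix.mulVec, dotProduct, Matrix.mul_apply, mul_comm]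
  · simp [Matrix.vecMul, dotProduct, Matrix.mul_apply]

theorem blockState_eq_mul_conjTranspose [Fintype e] (T : b → Matrix r e ℂ) :
    blockState T = (Matrix.of fun (p : r × b) f => T p.2 p.1 f) *
      (Matrix.of fun (p : r × b) f => T p.2 p.1 f)ᴴ := by
  ext p q
  simp [blockState, Matrix.mul_apply]

theorem blockState_posSemidef [Fintype r] [Fintype b] [Fintype e] (T : b → Matrix r e ℂ)
    : (blockState T).PosSemidef := by
  rw [blockState_eq_mul_conjTranspose]
  exact Matrix.posSemidef_self_mul_conjTranspose _

theorem trSnd_blockState [Fintype b] [Fintype e] (T : b → Matrix r e ℂ) :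
    trSnd (blockState T) = ∑ y, T y * (T y)ᴴ := by
  ext i j
  simp [trSnd, blockState, Matrix.sum_apply]

/-- The operator `tr_R[σ² (σ_R ⊗ 1)]` on `B`. -/
noncomputable def tiltedMarginal [Fintype r] [Fintype b] [DecidableEq b] (σ : Matrix (r × b)
    (r × b) ℂ) : Matrix b b ℂ :=
  trFst (σ * σ * (trSnd σ ⊗ₖ 1))

theorem tiltedMarginal_blockState_apply [Fintype r] [Fintype b] [DecidableEq b] [Fintype e]
    (T : b → Matrix r e ℂ) (y y' : b) :
    tiltedMarginal (blockState T) y y' =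
      ∑ z, (T y * (T z)ᴴ * (T z * (T y')ᴴ) * trSnd (blockState T)).trace := by
  set R := trSnd (blockState T)
  simp only [tiltedMarginal, trFst, Matrix.of_apply, Matrix.trace, Matrix.diag]
  rw [Finset.sum_comm]
  refine Finset.sum_congr rfl fun i _ => ?_
  have h1 : ∀ q : r × b, (blockState T * blockState T) (i, y) q =
      ∑ z, (T y * (T z)ᴴ * (T z * (T q.2)ᴴ)) i q.1 := by
    intro q
    rw [Matrix.mul_apply, Fintype.sum_prod_type, Finset.sum_comm]
    refine Finset.sum_congr rfl fun z _ => ?_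
    rw [Matrix.mul_apply]
    rfl
  rw [Matrix.mul_apply, Fintype.sum_prod_type]
  simp only [h1, Matrix.kroneckerMap_apply, Matrix.one_apply, mul_ite, mul_one, mul_zero,
    Finset.sum_ite_eq', Finset.mem_univ, if_true]
  simp only [Finset.sum_mul]
  rw [Finset.sum_comm]
  refine Finset.sum_congr rfl fun z _ => ?_
  rw [Matrix.mul_apply]

theorem IsPurification.conjTranspose_mul [Fintype r] {ψ : r × a → ℂ} {ρ : Matrix a a ℂ}
    (hψ : IsPurification ψ ρ) :
    (Matrix.of fun i x => ψ (i, x))ᴴ * (Matrix.of fun i x => ψ (i, x)) = ρᵀ := by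
  ext x y
  rw [← hψ]
  simp [trFst, proj, ketbra, vecMulVec_apply, Matrix.mul_apply, mul_comm]

/-- The isometry acts only on A, so it leaves the reference marginal unchanged: the blocks of V
enter through (V†V)ᵀ = 1. -/
theorem trSnd_blockState_block [Fintype a] [DecidableEq a] [Fintype b] [Fintype e] {ψ : r × a → ℂ}
    {V : Matrix (b × e) a ℂ} (hV : Vᴴ * V = 1) :
    trSnd (blockState (block ψ V)) =
      (Matrix.of fun i x => ψ (i, x)) * (Matrix.of fun i x => ψ (i, x))ᴴ := by
  rw [trSnd_blockState]
  have h : ∑ y, (Matrix.of fun f x => V (y, f) x)ᵀ * ((Matrix.of fun f x => V (y, f) x)ᵀ)ᴴ =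
      (1 : Matrix a a ℂ) := by
    rw [← Matrix.transpose_one, ← hV]
    ext x x'
    simp [Matrix.sum_apply, Matrix.mul_apply, Fintype.sum_prod_type, mul_comm]
  set P : Matrix r a ℂ := Matrix.of fun i x => ψ (i, x)
  calc ∑ y, block ψ V y * (block ψ V y)ᴴ
      = P * (∑ y, (Matrix.of fun f x => V (y, f) x)ᵀ *
          ((Matrix.of fun f x => V (y, f) x)ᵀ)ᴴ) * Pᴴ := by
        rw [Matrix.mul_sum, Matrix.sum_mul]
        refine Finset.sum_congr rfl fun y _ => ?_
        simp only [block, Matrix.conjTranspose_mul, Matrix.mul_assoc]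
        rfl
    _ = _ := by rw [h, Matrix.mul_one]

/-- The operator `tr_R[σ² (σ_R ⊗ 1)]` depends on the purification only through `ρ`. -/
theorem tiltedMarginal_block_apply [Fintype r] [Fintype a] [DecidableEq a] [Fintype b]
    [DecidableEq b] [Fintype e] {ψ : r × a → ℂ} {ρ : Matrix a a ℂ} (hψ : IsPurification ψ ρ)
    {V : Matrix (b × e) a ℂ} (hV : Vᴴ * V = 1) (y y' : b) :
    tiltedMarginal (blockState (block ψ V)) y y' =
      ∑ z, ((Matrix.of fun f x => V (y, f) x)ᵀ * ((Matrix.of fun f x => V (z, f) x)ᵀ)ᴴ * ρᵀ *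
        ((Matrix.of fun f x => V (z, f) x)ᵀ * ((Matrix.of fun f x => V (y', f) x)ᵀ)ᴴ) *
          (ρᵀ * ρᵀ)).trace := by
  rw [tiltedMarginal_blockState_apply, trSnd_blockState_block hV]
  refine Finset.sum_congr rfl fun z _ => ?_
  have hP := hψ.conjTranspose_mul
  simp only [block]
  generalize (Matrix.of fun i x => ψ (i, x) : Matrix r a ℂ) = P at *
  generalize (Matrix.of fun f x => V (y, f) x)ᵀ = A
  generalize (Matrix.of fun f x => V (z, f) x)ᵀ = B
  generalize (Matrix.of fun f x => V (y', f) x)ᵀ = C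
  rw [← hP]
  simp only [Matrix.conjTranspose_mul, Matrix.mul_assoc]
  -- Once the leading P is moved to the end by cyclicity, P occurs only in the products PᴴP = ρᵀ.
  rw [Matrix.trace_mul_comm P]
  simp only [Matrix.mul_assoc]

/-- Passes from RB to the complementary cut RE|B: the inner sum over z, isolated by cyclicity of the
trace, is the transposed marginal on E. The resulting form S†(σ_R ⊗ σ_E)S also shows that Z is
positive. -/
theorem tiltedMarginal_blockState_transpose [Fintype r] [Fintype b] [DecidableEq b] [Fintype e]
    (T : b → Matrix r e ℂ) :
    (tiltedMarginal (blockState T))ᵀ =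
      (Matrix.of fun (p : r × e) y => T y p.1 p.2)ᴴ *
        (trSnd (blockState T) ⊗ₖ (∑ z, (T z)ᴴ * T z)ᵀ) *
          (Matrix.of fun (p : r × e) y => T y p.1 p.2) := by
  ext y y'
  rw [Matrix.transpose_apply, tiltedMarginal_blockState_apply]
  set R := trSnd (blockState T)
  have h1 : ∑ z, (T y' * (T z)ᴴ * (T z * (T y)ᴴ) * R).trace =
      ((T y)ᴴ * R * T y' * (∑ z, (T z)ᴴ * T z)).trace := by
    rw [Matrix.mul_sum, Matrix.trace_sum]
    refine Finset.sum_congr rfl fun z _ => ?_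
    rw [Matrix.trace_mul_comm ((T y)ᴴ * R * T y')]
    simp only [Matrix.mul_assoc]
    rw [Matrix.trace_mul_comm (T y')]
    simp only [Matrix.mul_assoc]
  rw [h1]
  set F := ∑ z, (T z)ᴴ * T z
  set S : Matrix (r × e) b ℂ := Matrix.of fun (p : r × e) y => T y p.1 p.2
  have h2 : ∀ p : r × e, ((R ⊗ₖ Fᵀ) * S) p y' = (R * (T y' * F)) p.1 p.2 := by
    intro p
    rw [Matrix.mul_apply, Matrix.mul_apply, Fintype.sum_prod_type]
    refine Finset.sum_congr rfl fun i _ => ?_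
    rw [Matrix.mul_apply, Finset.mul_sum]
    refine Finset.sum_congr rfl fun f _ => ?_
    simp only [Matrix.kroneckerMap_apply, Matrix.transpose_apply, S, Matrix.of_apply]
    ring
  have h3 : (Sᴴ * (R ⊗ₖ Fᵀ) * S) y y' = ∑ p, Sᴴ y p * ((R ⊗ₖ Fᵀ) * S) p y' := by
    rw [Matrix.mul_assoc, Matrix.mul_apply]
  have h4 : ((T y)ᴴ * R * T y' * F).trace = ∑ f, ∑ i, (T y)ᴴ f i * (R * (T y' * F)) i f := by
    simp only [Matrix.mul_assoc, Matrix.trace, Matrix.diag_apply]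
    simp only [Matrix.mul_apply (M := (T y)ᴴ)]
  rw [h3, h4]
  simp only [h2]
  rw [Fintype.sum_prod_type, Finset.sum_comm]
  rfl

end Blocks

/-! ### Upper bound on the Rényi mutual information -/

section MutualInformation

variable {r b : Type*} [Fintype b]

theorem trace_mul_kronecker_one [Fintype r] [DecidableEq b] (X : Matrix (r × b) (r × b) ℂ)
    (A : Matrix r r ℂ) :
    (X * (A ⊗ₖ (1 : Matrix b b ℂ))).trace = (trSnd X * A).trace := by
  simp only [Matrix.trace, Matrix.diag_apply, Matrix.mul_apply, Fintype.sum_prod_type,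
    Matrix.kroneckerMap_apply, Matrix.one_apply, mul_ite, mul_one, mul_zero,
    Finset.sum_ite_eq', Finset.mem_univ, if_true, trSnd, Matrix.of_apply, Finset.sum_mul]
  exact Finset.sum_congr rfl fun i _ => Finset.sum_comm

theorem trace_mul_one_kronecker [Fintype r] [DecidableEq r] (X : Matrix (r × b) (r × b) ℂ)
    (B : Matrix b b ℂ) :
    (X * ((1 : Matrix r r ℂ) ⊗ₖ B)).trace = (trFst X * B).trace := by
  simp only [Matrix.trace, Matrix.diag_apply, Matrix.mul_apply, Fintype.sum_prod_type,
    Matrix.kroneckerMap_apply, Matrix.one_apply, ite_mul, mul_ite, one_mul, zero_mul, mul_zero,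
    Finset.sum_ite_irrel, Finset.sum_const_zero,
    Finset.sum_ite_eq', Finset.mem_univ, if_true, trFst, Matrix.of_apply, Finset.sum_mul]
  rw [Finset.sum_comm]
  exact Finset.sum_congr rfl fun i _ => Finset.sum_comm

theorem trace_mul_self_mul_kronecker [Fintype r] [DecidableEq r] [DecidableEq b]
    (σ : Matrix (r × b) (r × b) ℂ) (B : Matrix b b ℂ) :
    (σ * σ * (trSnd σ ⊗ₖ B)).trace = (tiltedMarginal σ * B).trace := by

    rw [tiltedMarginal, ← trace_mul_one_kronecker, Matrix.mul_assoc (σ * σ), ← Matrix.mul_kronecker_mul,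
    Matrix.mul_one, Matrix.one_mul]

theorem trSnd_posSemidef {σ : Matrix (r × b) (r × b) ℂ} (hσ : σ.PosSemidef) :
    (trSnd σ).PosSemidef := by
  have h : trSnd σ = ∑ k : b, σ.submatrix (fun i => (i, k)) (fun i => (i, k)) := by
    ext i j
    simp [trSnd, Matrix.sum_apply]
  rw [h]
  exact Matrix.posSemidef_sum _ fun k _ => hσ.submatrix _

/-- The trace is the squared Hilbert–Schmidt norm of SA. -/
theorem mul_eq_zero_of_trace_eq_zero {n : Type*} [Fintype n]
    {S A : Matrix n n ℂ} (hS : Sᴴ = S) (hA : Aᴴ = A) (h : (S * S * (A * A)).trace = 0) :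
    S * A = 0 := by
  rw [← Matrix.trace_conjTranspose_mul_self_eq_zero_iff, Matrix.conjTranspose_mul, hS, hA,
    Matrix.mul_assoc, Matrix.trace_mul_comm, ← h]
  simp only [Matrix.mul_assoc]

/-- Write P_d, P_e for the support projections of σ_R and Z, and Q_d, Q_e for their complements.
Then 1 = Q_d ⊗ 1 + P_d ⊗ Q_e + P_d ⊗ P_e, and σ annihilates the first two terms because tr[σ_R Q_d]
= 0 and tr[σ²(σ_R ⊗ Q_e)] = tr[Z Q_e] = 0. -/
theorem mul_support_eq_self [Fintype r] [DecidableEq r] [DecidableEq b] {σ : Matrix (r × b)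
    (r × b) ℂ} (hσ : σ.PosSemidef)
    {U : Matrix r r ℂ} (hU : U ∈ Matrix.unitaryGroup r ℂ) {d : r → ℝ} (hd : ∀ i, 0 ≤ d i)
    (hR : trSnd σ = U * diagonal (fun i => (d i : ℂ)) * Uᴴ)
    {U' : Matrix b b ℂ} (hU' : U' ∈ Matrix.unitaryGroup b ℂ) {e : b → ℝ}
    (hZ : tiltedMarginal σ = U' * diagonal (fun i => (e i : ℂ)) * U'ᴴ) :
    σ * ((U * diagonal (fun i => if d i = 0 then 0 else 1) * Uᴴ) ⊗ₖ
      (U' * diagonal (fun i => if e i = 0 then 0 else 1) * U'ᴴ)) = σ := by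
  have hσR : (trSnd σ).PosSemidef := trSnd_posSemidef hσ
  set Pd := U * diagonal (fun i => if d i = 0 then (0 : ℂ) else 1) * Uᴴ with hPd
  set Pe := U' * diagonal (fun i => if e i = 0 then (0 : ℂ) else 1) * U'ᴴ with hPe
  set Qd := U * diagonal (fun i => (((if d i = 0 then 1 else 0 : ℝ)) : ℂ)) * Uᴴ with hQd
  set Qe := U' * diagonal (fun i => (((if e i = 0 then 1 else 0 : ℝ)) : ℂ)) * U'ᴴ with hQe
  have hUr : U * Uᴴ = 1 := Matrix.mem_unitaryGroup_iff.1 hU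
  have hUr' : U' * U'ᴴ = 1 := Matrix.mem_unitaryGroup_iff.1 hU'
  have hPQd : Pd + Qd = 1 := by
    rw [hPd, hQd, ← Matrix.add_mul, ← Matrix.mul_add, Matrix.diagonal_add]
    have : (fun i => (if d i = 0 then (0 : ℂ) else 1) + ((if d i = 0 then 1 else 0 : ℝ) : ℂ)) =
        fun _ => 1 := by
      ext i; split_ifs <;> simp
    rw [this, Matrix.diagonal_one, Matrix.mul_one, hUr]
  have hPQe : Pe + Qe = 1 := by
    rw [hPe, hQe, ← Matrix.add_mul, ← Matrix.mul_add, Matrix.diagonal_add]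
    have : (fun i => (if e i = 0 then (0 : ℂ) else 1) + ((if e i = 0 then 1 else 0 : ℝ) : ℂ)) =
        fun _ => 1 := by
      ext i; split_ifs <;> simp
    rw [this, Matrix.diagonal_one, Matrix.mul_one, hUr']
  have hQd2 : Qd * Qd = Qd := by
    rw [hQd, conj_diagonal_mul hU]
    congr 3; ext i; split_ifs <;> simp
  have hQe2 : Qe * Qe = Qe := by
    rw [hQe, conj_diagonal_mul hU']
    congr 3; ext i; split_ifs <;> simp
  have hQdH : Qdᴴ = Qd := conj_diagonal_isHermitian _ _
  have hQeH : Qeᴴ = Qe := conj_diagonal_isHermitian _ _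
  have h1 : σ * (Qd ⊗ₖ 1) = 0 := by
    have h : psdPow σ (1 / 2) * (Qd ⊗ₖ 1) = 0 := by
      apply mul_eq_zero_of_trace_eq_zero (psdPow_half_isHermitian hσ)
      · rw [Matrix.conjTranspose_kronecker, hQdH, Matrix.conjTranspose_one]
      · rw [psdPow_half_mul_self hσ, ← Matrix.mul_kronecker_mul, hQd2, Matrix.one_mul,
          trace_mul_kronecker_one, hR, hQd, conj_diagonal_mul hU, trace_conj_diagonal hU]
        refine Finset.sum_eq_zero fun i _ => ?_
        split_ifs with h <;> simp [h]
    rw [← psdPow_half_mul_self hσ, Matrix.mul_assoc, h, Matrix.mul_zero]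
  have h2 : σ * (Pd ⊗ₖ Qe) = 0 := by
    have h : σ * (psdPow (trSnd σ) (1 / 2) ⊗ₖ Qe) = 0 := by
      apply mul_eq_zero_of_trace_eq_zero hσ.1
      · rw [Matrix.conjTranspose_kronecker, hQeH, psdPow_half_isHermitian hσR]
      · rw [← Matrix.mul_kronecker_mul, hQe2, psdPow_half_mul_self hσR,
          trace_mul_self_mul_kronecker, hZ, hQe, conj_diagonal_mul hU', trace_conj_diagonal hU']
        refine Finset.sum_eq_zero fun i _ => ?_
        split_ifs with h <;> simp [h]
    -- The trace identity only controls σ(σ_R^{1/2} ⊗ Q_e); the inverse root on the support turns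
    -- σ_R^{1/2} into P_d.
    have hp : psdPow (trSnd σ) (1 / 2) * psdPow (trSnd σ) (-1 / 2) = Pd := by
      rw [hR, psdPow_conj_diagonal hU, psdPow_conj_diagonal hU, conj_diagonal_mul hU]
      congr 3; ext i
      split_ifs with h
      · simp
      · rw [← Complex.ofReal_mul, ← Real.rpow_add (lt_of_le_of_ne (hd i) (Ne.symm h))]
        norm_num
    rw [← hp, ← Matrix.mul_one Qe, Matrix.mul_kronecker_mul, ← Matrix.mul_assoc, h,
      Matrix.zero_mul]
  have h3 : (1 : Matrix (r × b) (r × b) ℂ) = Qd ⊗ₖ 1 + (Pd ⊗ₖ Qe + Pd ⊗ₖ Pe) := by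
    rw [← Matrix.kronecker_add, add_comm Qe, hPQe, ← Matrix.add_kronecker, add_comm Qd, hPQd,
      Matrix.one_kronecker_one]
  conv_rhs => rw [← Matrix.mul_one σ, h3, Matrix.mul_add, Matrix.mul_add, h1, h2, zero_add,
    zero_add]

theorem petzMutualInfoDown_two_le [Fintype r] [DecidableEq r] [DecidableEq b] {σ : Matrix (r × b)
    (r × b) ℂ} (hσ : IsState σ)
    (hZ : (tiltedMarginal σ).PosSemidef) :
    petzMutualInfoDown 2 σ (psdPow (trSnd σ) (-1)) ≤
      log2 (sqrtRootSum (tiltedMarginal σ).charpoly ^ 2) := by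
  have hσR : (trSnd σ).PosSemidef := trSnd_posSemidef hσ.1
  obtain ⟨U, hU, d, hd, hR⟩ := exists_conj_diagonal hσR
  obtain ⟨U', hU', e, he, hZe⟩ := exists_conj_diagonal hZ
  have hsupp := mul_support_eq_self hσ.1 hU hd hR hU' hZe
  have hroot : sqrtRootSum (tiltedMarginal σ).charpoly = ∑ i, Real.sqrt (e i) := by
    rw [hZe, sqrtRootSum_charpoly_conj_diagonal hU']
  rw [hroot]
  set c := ∑ i, Real.sqrt (e i) with hc
  -- If c = 0 then Z = 0, its support projection vanishes, and the support lemma forces σ = 0,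
  -- contradicting trace one.
  have hcpos : 0 < c := by
    refine lt_of_le_of_ne (Finset.sum_nonneg fun i _ => Real.sqrt_nonneg _) fun h0 => ?_
    have he0 : ∀ i, e i = 0 := fun i => by
      have := (Finset.sum_eq_zero_iff_of_nonneg fun i _ => Real.sqrt_nonneg (e i)).1
        h0.symm i (Finset.mem_univ i)
      exact (Real.sqrt_eq_zero (he i)).1 this
    have hz : σ = 0 := by
      rw [← hsupp]
      simp [he0]
    have := hσ.2
    rw [hz] at this
    simp at this
  -- τ = Z^{1/2} / tr Z^{1/2}: weights proportional to √eᵢ minimise Σ eᵢ/tᵢ over probability vectors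
  -- t, with minimum (Σ √eᵢ)².
  set τ := U' * diagonal (fun i => ((Real.sqrt (e i) / c : ℝ) : ℂ)) * U'ᴴ with hτ
  have hτpos : τ.PosSemidef :=
    conj_diagonal_posSemidef U' fun i => div_nonneg (Real.sqrt_nonneg _) hcpos.le
  have hτs : IsState τ := by
    refine ⟨hτpos, ?_⟩
    rw [hτ, trace_conj_diagonal hU', ← Complex.ofReal_sum, ← Finset.sum_div, ← hc,
      div_self hcpos.ne', Complex.ofReal_one]
  have hX : psdPow (trSnd σ) (-1) =
      U * diagonal (fun i => ((if d i = 0 then 0 else d i ^ (-1 : ℝ) : ℝ) : ℂ)) * Uᴴ := by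
    rw [hR, psdPow_conj_diagonal hU]
  have hXpos : (psdPow (trSnd σ) (-1)).PosSemidef := by
    rw [hX]
    refine conj_diagonal_posSemidef U fun i => ?_
    split_ifs
    · exact le_rfl
    · exact Real.rpow_nonneg (hd i) _
  have hXX : psdPow (psdPow (trSnd σ) (-1)) (-1) = trSnd σ := by
    rw [hX, psdPow_conj_diagonal hU, hR]
    congr 3; ext i
    by_cases h : d i = 0
    · simp [h]
    · simp [h, Real.rpow_neg_one]
  have hττ : psdPow τ (-1) =
      U' * diagonal (fun i => ((if e i = 0 then 0 else c / Real.sqrt (e i) : ℝ) : ℂ)) * U'ᴴ := by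
    rw [hτ, psdPow_conj_diagonal hU']
    congr 3; ext i
    by_cases h : e i = 0
    · simp [h]
    · have : Real.sqrt (e i) ≠ 0 := by rwa [Ne, Real.sqrt_eq_zero (he i)]
      simp [h, this, hcpos.ne', Real.rpow_neg_one]
  -- Multiplying σ_R^{-1} ⊗ τ by its inverse on the support gives the projection that σ absorbs, so
  -- whatever σ_R^{-1} ⊗ τ kills is killed by σ.
  have hdom : Dominated σ (psdPow (trSnd σ) (-1) ⊗ₖ τ) := by
    intro v hv
    have hinv : (trSnd σ ⊗ₖ psdPow τ (-1)) * (psdPow (trSnd σ) (-1) ⊗ₖ τ) =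
        ((U * diagonal (fun i => if d i = 0 then 0 else 1) * Uᴴ) ⊗ₖ
          (U' * diagonal (fun i => if e i = 0 then 0 else 1) * U'ᴴ)) := by
      rw [← Matrix.mul_kronecker_mul, hττ, hX, hτ, conj_diagonal_mul hU', hR,
        conj_diagonal_mul hU]
      congr 4
      · ext i
        by_cases h : d i = 0
        · simp [h]
        · simp [h, Real.rpow_neg_one]
      · ext i
        by_cases h : e i = 0
        · simp [h]
        · have : Real.sqrt (e i) ≠ 0 := by rwa [Ne, Real.sqrt_eq_zero (he i)]
          simp only [h, if_false]
          rw [← Complex.ofReal_mul]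
          field_simp
          simp
    rw [← hsupp, ← hinv, ← Matrix.mulVec_mulVec, ← Matrix.mulVec_mulVec, hv, Matrix.mulVec_zero,
      Matrix.mulVec_zero]
  have hval : (psdPow σ 2 * psdPow (psdPow (trSnd σ) (-1) ⊗ₖ τ) (1 - 2)).trace.re = c ^ 2 := by
    have h12 : (1 - 2 : ℝ) = -1 := by norm_num
    rw [h12, psdPow_two hσ.1, psdPow_kronecker hXpos hτpos, hXX, trace_mul_self_mul_kronecker,
      hZe, hττ, conj_diagonal_mul hU', trace_conj_diagonal hU']
    have h : ∀ i, (e i : ℂ) * ((if e i = 0 then 0 else c / Real.sqrt (e i) : ℝ) : ℂ) =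
        ((c * Real.sqrt (e i) : ℝ) : ℂ) := by
      intro i
      rw [← Complex.ofReal_mul]
      congr 1
      by_cases h : e i = 0
      · simp [h]
      · have h0 : Real.sqrt (e i) ≠ 0 := by rwa [Ne, Real.sqrt_eq_zero (he i)]
        simp only [h, if_false]
        field_simp
        rw [Real.sq_sqrt (he i)]
    rw [Finset.sum_congr rfl fun i _ => h i, ← Complex.ofReal_sum, Complex.ofReal_re,
      ← Finset.mul_sum, ← hc, sq]
  refine (iInf_le _ ⟨τ, hτs⟩).trans ?_
  rw [petzDiv, if_pos (Or.inr hdom), hval, log2, if_pos (by positivity)]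
  norm_num

end MutualInformation

/-! ### Orthonormal bases as matrices, and Cauchy–Schwarz -/

section Bases

variable {n m : Type*}

/-- The matrix whose columns are a given family of vectors. -/
noncomputable def colMatrix (v : m → EuclideanSpace ℂ n) : Matrix n m ℂ :=
  Matrix.of fun i k => v k i

theorem colMatrix_conjTranspose_mul_self [Fintype n] [DecidableEq m] {v : m → EuclideanSpace ℂ n}
    (hv : Orthonormal ℂ v) :
    (colMatrix v)ᴴ * colMatrix v = 1 := by
  ext k l
  have h := orthonormal_iff_ite.1 hv k l
  rw [Matrix.one_apply, ← h]
  simp [colMatrix, Matrix.mul_apply, PiLp.inner_apply, mul_comm]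

theorem colMatrix_mem_unitaryGroup [Fintype n] [DecidableEq n]
    (v : OrthonormalBasis n ℂ (EuclideanSpace ℂ n)) :
    colMatrix v ∈ Matrix.unitaryGroup n ℂ :=
  Matrix.mem_unitaryGroup_iff'.2 (colMatrix_conjTranspose_mul_self v.orthonormal)

theorem sum_smul_ketbra [Fintype m] [DecidableEq m] (A : Matrix n m ℂ) (c : m → ℂ) :
    ∑ p, c p • proj (fun i => A i p) = A * diagonal c * Aᴴ := by
  ext i j
  rw [Matrix.sum_apply, Matrix.mul_apply]
  refine Finset.sum_congr rfl fun p _ => ?_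
  rw [Matrix.mul_diagonal]
  simp [proj, ketbra, vecMulVec_apply]
  ring

theorem normSq_sum_mul_le {ι : Type*} [Fintype ι] (f g : ι → ℂ)
    (hf : ∑ i, Complex.normSq (f i) = 1) :
    Complex.normSq (∑ i, f i * g i) ≤ ∑ i, Complex.normSq (g i) := by
  simp only [Complex.normSq_eq_norm_sq] at *
  have h1 : ‖∑ i, f i * g i‖ ≤ ∑ i, ‖f i‖ * ‖g i‖ :=
    (norm_sum_le _ _).trans (Finset.sum_le_sum fun i _ => norm_mul_le _ _)
  calc ‖∑ i, f i * g i‖ ^ 2 ≤ (∑ i, ‖f i‖ * ‖g i‖) ^ 2 := by gcongr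
    _ ≤ (∑ i, ‖f i‖ ^ 2) * ∑ i, ‖g i‖ ^ 2 := Finset.sum_mul_sq_le_sq_mul_sq _ _ _
    _ = _ := by rw [hf, one_mul]

end Bases

/-! ### Marginals of |σ⟩ and the spectrum of M -/

namespace SWBase

variable {a b : Type*} [Fintype a] [DecidableEq a] [Fintype b] [DecidableEq b] {d : ℕ}
  {ρ : Matrix a a ℂ} {N : Matrix a a ℂ →ₗ[ℂ] Matrix b b ℂ} (S : SWBase d ρ N)

/-- The unitary with columns `|rₖ⟩ ⊗ |eₗ⟩`. -/
noncomputable def phiMatrix : Matrix (Fin d × (a × b)) (Fin d × (a × b)) ℂ :=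
  colMatrix S.rb ⊗ₖ colMatrix S.eb

theorem phiMatrix_mem_unitaryGroup :
    S.phiMatrix ∈ Matrix.unitaryGroup (Fin d × (a × b)) ℂ :=
  Matrix.kronecker_mem_unitary (colMatrix_mem_unitaryGroup _) (colMatrix_mem_unitaryGroup _)

theorem phi_eq (p : Fin d × (a × b)) : S.phi p = fun i => S.phiMatrix i p := rfl

/-- The coefficient matrix of `|ρ⟩`. -/
theorem ketRho_matrix : (Matrix.of fun i x => S.ketRho (i, x)) =
    colMatrix S.rb * diagonal (fun k => ((Real.sqrt (S.lam k) : ℝ) : ℂ)) * (colMatrix S.av)ᵀ := by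
  ext i x
  rw [Matrix.mul_apply]
  simp only [ketRho, Matrix.of_apply, Finset.sum_apply, Matrix.mul_diagonal]
  refine Finset.sum_congr rfl fun k _ => ?_
  simp [tens, colMatrix]
  ring

theorem isPurification_ketRho : IsPurification S.ketRho ρ := S.schmidt

theorem ketSigma_apply (i : Fin d) (y : b) (f : a × b) :
    S.ketSigma (i, (y, f)) = block S.ketRho S.V y i f := by
  simp only [ketSigma, Matrix.mulVec, dotProduct, block, Matrix.mul_apply,
    Fintype.sum_prod_type, Matrix.kroneckerMap_apply, Matrix.one_apply, ite_mul, one_mul, zero_mul,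
    Finset.sum_ite_irrel, Finset.sum_const_zero, Finset.sum_ite_eq, Finset.mem_univ, if_true,
    Matrix.of_apply, Matrix.transpose_apply]
  exact Finset.sum_congr rfl fun x _ => mul_comm _ _

/-- The coefficient matrix of `|σ⟩` with respect to the cut `RE|B`. -/
noncomputable def sigmaMatrix : Matrix (Fin d × (a × b)) b ℂ :=
  Matrix.of fun p y => block S.ketRho S.V y p.1 p.2

theorem sigmaRE_eq : S.sigmaRE = S.sigmaMatrix * S.sigmaMatrixᴴ := by
  ext p q
  simp [sigmaRE, sigmaMatrix, Matrix.mul_apply, ketSigma_apply]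

theorem sigmaRE_posSemidef : S.sigmaRE.PosSemidef := by
  rw [sigmaRE_eq]
  exact Matrix.posSemidef_self_mul_conjTranspose _

theorem trSnd_sigmaRE_eq_trSnd_blockState :
    trSnd S.sigmaRE = trSnd (blockState (block S.ketRho S.V)) := by
  rw [trSnd_blockState]
  ext i j
  simp only [trSnd, sigmaRE, ketSigma_apply, Matrix.of_apply, Matrix.sum_apply, Matrix.mul_apply,
    Matrix.conjTranspose_apply]
  exact Finset.sum_comm

theorem trSnd_sigmaRE : trSnd S.sigmaRE =
    colMatrix S.rb * diagonal (fun k => (S.lam k : ℂ)) * (colMatrix S.rb)ᴴ := by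
  rw [trSnd_sigmaRE_eq_trSnd_blockState, trSnd_blockState_block S.V_isometry, ketRho_matrix]
  have h : (colMatrix S.av)ᵀ * ((colMatrix S.av)ᵀ)ᴴ = 1 := by
    rw [← Matrix.transpose_one, ← colMatrix_conjTranspose_mul_self S.av_orthonormal,
      Matrix.transpose_mul]
    rfl
  have hl : diagonal (fun k => ((Real.sqrt (S.lam k) : ℝ) : ℂ)) *
      (diagonal (fun k => ((Real.sqrt (S.lam k) : ℝ) : ℂ)))ᴴ =
        diagonal (fun k => (S.lam k : ℂ)) := by
    rw [Matrix.diagonal_conjTranspose, Matrix.diagonal_mul_diagonal]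
    congr 1
    ext k
    rw [Pi.star_apply, Complex.star_def, Complex.conj_ofReal, ← Complex.ofReal_mul,
      Real.mul_self_sqrt (S.lam_nonneg k)]
  rw [← hl]
  simp only [Matrix.conjTranspose_mul, Matrix.mul_assoc]
  rw [← Matrix.mul_assoc (colMatrix S.av)ᵀ, h, Matrix.one_mul]

theorem trFst_sigmaRE_eq_sum : trFst S.sigmaRE =
    (∑ z, (block S.ketRho S.V z)ᴴ * block S.ketRho S.V z)ᵀ := by
  ext f g
  simp only [trFst, sigmaRE, ketSigma_apply, Matrix.of_apply, Matrix.transpose_apply,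
    Matrix.sum_apply, Matrix.mul_apply, Matrix.conjTranspose_apply]
  rw [Finset.sum_comm]
  simp only [mul_comm]

theorem trFst_sigmaRE : trFst S.sigmaRE =
    colMatrix S.eb * diagonal (fun l => (S.mu l : ℂ)) * (colMatrix S.eb)ᴴ := by
  have h : trFst S.sigmaRE = trFst (S.V * ρ * S.Vᴴ) := by
    have hρ := S.isPurification_ketRho.conjTranspose_mul
    rw [trFst_sigmaRE_eq_sum]
    ext f g
    simp only [trFst, Matrix.transpose_apply, Matrix.sum_apply, Matrix.of_apply]
    refine Finset.sum_congr rfl fun z _ => ?_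
    rw [block, Matrix.conjTranspose_mul, Matrix.mul_assoc, ← Matrix.mul_assoc _ᴴ _ _ᵀ, hρ]
    rw [← Matrix.transpose_apply (_ * _)]
    simp only [Matrix.transpose_mul, Matrix.transpose_transpose]
    rfl
  rw [h, S.spectral, ← sum_smul_ketbra]
  rfl

theorem sigmaHat_eq : S.sigmaHat =
    S.phiMatrix * diagonal (fun p => ((S.lam p.1 * S.mu p.2 : ℝ) : ℂ)) * S.phiMatrixᴴ := by
  rw [sigmaHat, trSnd_sigmaRE, trFst_sigmaRE, conj_diagonal_kronecker]
  simp only [Complex.ofReal_mul]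
  rfl

theorem sigmaHat_posSemidef : S.sigmaHat.PosSemidef := by
  rw [sigmaHat_eq]
  exact conj_diagonal_posSemidef _ fun p => mul_nonneg (S.lam_nonneg _) (S.mu_nonneg _)

theorem psdPow_sigmaHat_half : psdPow S.sigmaHat (1 / 2) =
    S.phiMatrix * diagonal (fun p => ((Real.sqrt (S.lam p.1) * Real.sqrt (S.mu p.2) : ℝ) : ℂ)) *
      S.phiMatrixᴴ := by
  rw [sigmaHat_eq, psdPow_conj_diagonal S.phiMatrix_mem_unitaryGroup]
  congr 3
  ext p
  rw [← Real.sqrt_mul (S.lam_nonneg _)]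
  split_ifs with h
  · simp [h]
  · rw [Real.sqrt_eq_rpow]

theorem tiltedMarginal_transpose :
    (tiltedMarginal (blockState (block S.ketRho S.V)))ᵀ =
      S.sigmaMatrixᴴ * S.sigmaHat * S.sigmaMatrix := by
  rw [tiltedMarginal_blockState_transpose, sigmaHat, trSnd_sigmaRE_eq_trSnd_blockState,
    trFst_sigmaRE_eq_sum]
  rfl

/-- M is the transpose, taken in the basis φ, of (σ_R ⊗ σ_E)^{1/2} σ_RE^{1/2}. -/
theorem M_eq : S.M = S.phiMatrix * (S.phiMatrixᴴ *
    (psdPow S.sigmaHat (1 / 2) * psdPow S.sigmaRE (1 / 2)) * S.phiMatrix)ᵀ * S.phiMatrixᴴ := by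
  set G := psdPow S.sigmaHat (1 / 2) * psdPow S.sigmaRE (1 / 2) with hG
  have h : ∀ p q, star (S.phi p) ⬝ᵥ (G *ᵥ S.phi q) = (S.phiMatrixᴴ * G * S.phiMatrix) p q := by
    intro p q
    rw [Matrix.mul_assoc, Matrix.mul_apply]
    rfl
  ext i j
  rw [M, ← hG, Matrix.mul_apply]
  simp only [Matrix.sum_apply]
  refine Finset.sum_congr rfl fun p _ => ?_
  rw [Matrix.mul_apply, Finset.sum_mul]
  refine Finset.sum_congr rfl fun q _ => ?_
  rw [h]
  simp only [Matrix.smul_apply, smul_eq_mul, ketbra, vecMulVec_apply, Matrix.transpose_apply,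
    Pi.star_apply, phi_eq, Matrix.conjTranspose_apply]
  ring

/-- With A = (σ_R ⊗ σ_E)^{1/2}, B = σ_RE^{1/2} and S the coefficient matrix of |σ⟩, the matrix MM†
is, up to a unitary change of basis and a transpose, BA²B. Cyclic moves link this to A²B² = (σ_R ⊗
σ_E) SS† and then to S†(σ_R ⊗ σ_E)S = Zᵀ. -/
theorem sqrtRootSum_charpoly_M :
    sqrtRootSum (S.M * S.Mᴴ).charpoly =
      sqrtRootSum (tiltedMarginal (blockState (block S.ketRho S.V))).charpoly := by
  have hUl : S.phiMatrixᴴ * S.phiMatrix = 1 :=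
    Matrix.mem_unitaryGroup_iff'.1 S.phiMatrix_mem_unitaryGroup
  have hUr : S.phiMatrix * S.phiMatrixᴴ = 1 :=
    Matrix.mem_unitaryGroup_iff.1 S.phiMatrix_mem_unitaryGroup
  rw [← Matrix.charpoly_transpose (tiltedMarginal _), tiltedMarginal_transpose,
    sqrtRootSum_charpoly_mul_comm _ S.sigmaMatrix, ← Matrix.mul_assoc, ← sigmaRE_eq,
    ← psdPow_half_mul_self S.sigmaHat_posSemidef]
  conv_rhs => rw [← psdPow_half_mul_self S.sigmaRE_posSemidef]
  have hA := psdPow_half_isHermitian S.sigmaHat_posSemidef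
  have hB := psdPow_half_isHermitian S.sigmaRE_posSemidef
  rw [M_eq]
  generalize psdPow S.sigmaHat (1 / 2) = A at *
  generalize psdPow S.sigmaRE (1 / 2) = B at *
  generalize S.phiMatrix = F at *
  -- Transposition reverses products, so MM† involves (AB)†(AB), not (AB)(AB)†.
  have e1 : F * (Fᴴ * (A * B) * F)ᵀ * Fᴴ * (F * (Fᴴ * (A * B) * F)ᵀ * Fᴴ)ᴴ =
      F * ((Fᴴ * (B * A * (A * B)) * F)ᵀ * Fᴴ) := by
    have e2 : (Fᴴ * (B * A * (A * B)) * F)ᵀ =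
        (Fᴴ * (A * B) * F)ᵀ * ((Fᴴ * (A * B) * F)ᵀ)ᴴ := by
      have e3 : ((Fᴴ * (A * B) * F)ᵀ)ᴴ = ((Fᴴ * (A * B) * F)ᴴ)ᵀ := rfl
      rw [e3, ← Matrix.transpose_mul]
      congr 1
      simp only [Matrix.conjTranspose_mul, Matrix.conjTranspose_conjTranspose, hA, hB,
        Matrix.mul_assoc]
      rw [← Matrix.mul_assoc F Fᴴ, hUr, Matrix.one_mul]
    rw [e2]
    generalize (Fᴴ * (A * B) * F)ᵀ = G
    simp only [Matrix.conjTranspose_mul, Matrix.conjTranspose_conjTranspose, Matrix.mul_assoc]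
    rw [← Matrix.mul_assoc Fᴴ F, hUl, Matrix.one_mul]
  rw [e1, Matrix.charpoly_mul_comm, Matrix.mul_assoc, hUl, Matrix.mul_one,
    Matrix.charpoly_transpose, Matrix.charpoly_mul_comm, ← Matrix.mul_assoc, hUr, Matrix.one_mul,
    Matrix.mul_assoc, Matrix.charpoly_mul_comm]
  simp only [Matrix.mul_assoc]
  rw [← Matrix.mul_assoc, Matrix.charpoly_mul_comm, Matrix.mul_assoc]

end SWBase

/-! ### Singular values of M -/

namespace SWConstruction

variable {a b : Type*} [Fintype a] [DecidableEq a] [Fintype b] [DecidableEq b] {d : ℕ}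
  {ρ : Matrix a a ℂ} {N : Matrix a a ℂ →ₗ[ℂ] Matrix b b ℂ} (S : SWConstruction d ρ N)

theorem svd_conj_diagonal : S.M =
    S.Uhat * (S.phiMatrix * diagonal (fun p => (S.sv p : ℂ)) * S.phiMatrixᴴ) * S.Util := by
  rw [S.svd, ← sum_smul_ketbra]
  rfl

theorem sum_sv : ∑ p, S.sv p =
    sqrtRootSum (tiltedMarginal (blockState (block S.ketRho S.V))).charpoly := by
  have hUt : S.Util * S.Utilᴴ = 1 := Matrix.mem_unitaryGroup_iff.1 S.Util_unitary
  have h : S.M * S.Mᴴ = (S.Uhat * S.phiMatrix) *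
      diagonal (fun p => ((S.sv p ^ 2 : ℝ) : ℂ)) * (S.Uhat * S.phiMatrix)ᴴ := by
    have h2 : (fun p => ((S.sv p ^ 2 : ℝ) : ℂ)) = fun p => (S.sv p : ℂ) * (S.sv p : ℂ) := by
      ext p
      push_cast
      ring
    rw [svd_conj_diagonal, h2, Matrix.conjTranspose_mul, Matrix.conjTranspose_mul,
      conj_diagonal_isHermitian, Matrix.mul_assoc, ← Matrix.mul_assoc S.Util, hUt, Matrix.one_mul,
      ← Matrix.mul_assoc, Matrix.mul_assoc S.Uhat,
      conj_diagonal_mul S.phiMatrix_mem_unitaryGroup, Matrix.conjTranspose_mul]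
    simp only [Matrix.mul_assoc]
  rw [← S.sqrtRootSum_charpoly_M, h, sqrtRootSum_charpoly_conj_diagonal
    (mul_mem S.Uhat_unitary S.phiMatrix_mem_unitaryGroup)]
  exact Finset.sum_congr rfl fun p _ => (Real.sqrt_sq (S.sv_nonneg p)).symm

/-- U undoes both unitaries of the singular value decomposition under the trace; this is what makes
it the right rotation for the decoder. -/
theorem trace_M_mul_U : (S.M * S.U).trace = ((∑ p, S.sv p : ℝ) : ℂ) := by
  have hUt : S.Util * S.Utilᴴ = 1 := Matrix.mem_unitaryGroup_iff.1 S.Util_unitary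
  have hUh : S.Uhatᴴ * S.Uhat = 1 := Matrix.mem_unitaryGroup_iff'.1 S.Uhat_unitary
  rw [svd_conj_diagonal, U, Matrix.mul_assoc, ← Matrix.mul_assoc S.Util, hUt, Matrix.one_mul,
    Matrix.trace_mul_comm, ← Matrix.mul_assoc, hUh, Matrix.one_mul,
    trace_conj_diagonal S.phiMatrix_mem_unitaryGroup, Complex.ofReal_sum]

end SWConstruction

/-- The fidelity as a sum over the Kraus branches of the output. -/
theorem purifiedFidelity_eq_sum_normSq {r a ι : Type*} [Fintype r] [Fintype a] [Fintype ι]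
    {ψ : r × a → ℂ} {L : Matrix a a ℂ →ₗ[ℂ] Matrix a a ℂ} {ζ : ι → r × a → ℂ}
    (h : idTensor r L (proj ψ) = ∑ j, proj (ζ j)) :
    purifiedFidelity ψ L = ∑ j, Complex.normSq (star ψ ⬝ᵥ ζ j) := by
  rw [purifiedFidelity, h, Matrix.sum_mulVec, dotProduct_sum, Complex.re_sum]
  refine Finset.sum_congr rfl fun j _ => ?_
  rw [proj, ketbra, Matrix.vecMulVec_mulVec]
  have h2 : star (ζ j) ⬝ᵥ ψ = star (star ψ ⬝ᵥ ζ j) := by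
    rw [Matrix.star_dotProduct]
  simp only [h2, dotProduct_smul]
  simp [Complex.normSq_apply]

/-! ### Lower bound on the entanglement fidelity of the decoder -/

namespace SWConstruction

variable {a b : Type*} [Fintype a] [DecidableEq a] [Fintype b] [DecidableEq b] {d : ℕ}
  {ρ : Matrix a a ℂ} {N : Matrix a a ℂ →ₗ[ℂ] Matrix b b ℂ} (S : SWConstruction d ρ N)

/-- The coefficient matrix of `|σ⟩ ⊗ |0⟩`. -/
noncomputable def ketSigmaZeroMatrix : Matrix (Fin d × (a × b)) (Fin d × (a × b)) ℂ :=
  Matrix.of fun p q => S.ketSigmaZero (p, q)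

/-- An operator on the second tensor factor multiplies the coefficient matrix on the right by its
transpose, and |Ω⟩ has coefficient matrix FFᵀ, where F has the columns φ. -/
theorem ketSigmaZeroMatrix_mul_transpose_W : S.ketSigmaZeroMatrix * S.Wᵀ =
    psdPow S.sigmaRE (1 / 2) * (S.phiMatrix * S.phiMatrixᵀ) := by
  have h1 : S.ketSigmaZeroMatrix * S.Wᵀ = Matrix.of fun p q => S.PsiSigma (p, q) := by
    ext p q
    rw [Matrix.of_apply, S.W_spec]
    simp only [Matrix.mulVec, dotProduct, Matrix.mul_apply, ketSigmaZeroMatrix,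
      Fintype.sum_prod_type (α₁ := Fin d × (a × b)), Matrix.kroneckerMap_apply, Matrix.one_apply,
      ite_mul, one_mul, zero_mul, Finset.sum_ite_irrel, Finset.sum_const_zero, Finset.sum_ite_eq,
      Finset.mem_univ, if_true, Matrix.of_apply, Matrix.transpose_apply]
    exact Finset.sum_congr rfl fun x _ => mul_comm _ _
  have h2 : (Matrix.of fun p q => S.Omega (p, q)) = S.phiMatrix * S.phiMatrixᵀ := by
    ext p q
    simp [SWBase.Omega, Matrix.mul_apply, tens, SWBase.phi_eq]
  rw [h1, ← h2]
  ext p q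
  rw [Matrix.of_apply]
  simp only [SWBase.PsiSigma, Matrix.mulVec, dotProduct, Matrix.mul_apply,
    Fintype.sum_prod_type (α₁ := Fin d × (a × b)), Matrix.kroneckerMap_apply, Matrix.one_apply,
    mul_ite, mul_one, mul_zero, ite_mul, zero_mul, Finset.sum_ite_eq,
    Finset.mem_univ, if_true, Matrix.of_apply]

/-- The columns `|rₖ⟩ ⊗ |eₗ⟩` of the basis with a fixed `l`. -/
noncomputable def phiColumns (l : a × b) : Matrix (Fin d × (a × b)) (Fin d) ℂ :=
  Matrix.of fun q k => S.phiMatrix q (k, l)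

theorem K_eq (l : a × b) :
    S.K l = colMatrix S.av * (S.phiColumns l)ᴴ * S.U * S.W := by
  rw [K]
  congr 2
  ext x q
  rw [Matrix.sum_apply, Matrix.mul_apply]
  rfl

/-- The vector obtained from `|σ⟩ ⊗ |0⟩` by applying `K_l` and projecting `E` onto `|f⟩`. -/
noncomputable def branch (j : (a × b) × (a × b)) : Fin d × a → ℂ :=
  fun p => (S.ketSigmaZeroMatrix * (S.K j.1)ᵀ) (p.1, j.2) p.2

/-- Tracing out E in the Stinespring form contributes one pure term per basis vector f of E, and
each Kraus operator K_l keeps such a term pure. -/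
theorem idTensor_decoder_eq_sum_branch :
    idTensor (Fin d) (S.decoder ∘ₗ N) (proj S.ketRho) = ∑ j, proj (S.branch j) := by
  ext p p'
  set T : Matrix a a ℂ := Matrix.of fun x y => proj S.ketRho (p.1, x) (p'.1, y) with hT
  have hN : ∀ y y', N T y y' =
      ∑ f, S.ketSigma (p.1, (y, f)) * star (S.ketSigma (p'.1, (y', f))) := by
    intro y y'
    have h := congrFun (congrFun (idTensor_proj_eq_blockState S.ketRho S.V S.stinespring)
      (p.1, y)) (p'.1, y')
    simp only [SWBase.ketSigma_apply]
    exact h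
  have hA : S.appendZero (N T) = ∑ f, ketbra (fun q => S.ketSigmaZeroMatrix (p.1, f) q)
      (fun q => S.ketSigmaZeroMatrix (p'.1, f) q) := by
    ext q q'
    simp only [SWBase.appendZero, Matrix.of_apply, hN, Matrix.sum_apply, ketbra, vecMulVec_apply,
      Finset.sum_mul, ketSigmaZeroMatrix, SWBase.ketSigmaZero, Pi.star_apply, star_mul']
    refine Finset.sum_congr rfl fun f _ => ?_
    ring
  have hb : ∀ l f (i : Fin d) x, (S.K l *ᵥ fun q => S.ketSigmaZeroMatrix (i, f) q) x =
      S.branch (l, f) (i, x) := by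
    intro l f i x
    simp [branch, Matrix.mulVec, dotProduct, Matrix.mul_apply, mul_comm]
  change (S.decoder (N T)) p.2 p'.2 = _
  simp only [decoder, LinearMap.coe_mk, AddHom.coe_mk, hA, Matrix.mul_sum, Matrix.sum_mul,
    Matrix.sum_apply, Fintype.sum_prod_type (α₁ := a × b)]
  refine Finset.sum_congr rfl fun l _ => Finset.sum_congr rfl fun f _ => ?_
  rw [ketbra, Matrix.mul_vecMulVec, Matrix.vecMulVec_mul, vecMulVec_apply, ← Matrix.star_mulVec,
    Pi.star_apply, hb, hb]
  rfl

/-- The amplitude of `|rₖ eₗ⟩ ⊗ |rₖ eₗ⟩` in `U W (|σ⟩ ⊗ |0⟩)`. -/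
noncomputable def amplitude (p : Fin d × (a × b)) : ℂ :=
  (S.phiMatrixᴴ * (S.ketSigmaZeroMatrix * S.Wᵀ * S.Uᵀ) * (S.phiMatrixᴴ)ᵀ) p p

/-- The Schmidt form of |ρ⟩ gives ⟨ρ| Σₖ |aₖ⟩⟨φ_{k,l}| = Σₖ √λₖ ⟨rₖ| ⊗ ⟨φ_{k,l}|. Contracting E with
⟨e_l| completes ⟨rₖ| to ⟨φ_{k,l}|, which leaves only diagonal amplitudes. -/
theorem sum_star_eb_mul_branch (l : a × b) :
    ∑ f, star (S.eb l f) * (star S.ketRho ⬝ᵥ S.branch (l, f)) =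
      ∑ k, ((Real.sqrt (S.lam k) : ℝ) : ℂ) * S.amplitude (k, l) := by
  set Y := S.ketSigmaZeroMatrix * S.Wᵀ * S.Uᵀ with hY
  set C : Matrix (Fin d) a ℂ := Matrix.of fun i x => S.ketRho (i, x) with hC
  have hK : S.ketSigmaZeroMatrix * (S.K l)ᵀ = Y * (colMatrix S.av * (S.phiColumns l)ᴴ)ᵀ := by
    rw [K_eq, hY]
    simp only [Matrix.transpose_mul, Matrix.mul_assoc]
  have hCP : (Cᴴ)ᵀ * (colMatrix S.av * (S.phiColumns l)ᴴ) =
      ((colMatrix S.rb)ᴴ)ᵀ * diagonal (fun k => ((Real.sqrt (S.lam k) : ℝ) : ℂ)) *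
        (S.phiColumns l)ᴴ := by
    have hD : (diagonal (fun k => ((Real.sqrt (S.lam k) : ℝ) : ℂ)))ᴴ =
        diagonal (fun k => ((Real.sqrt (S.lam k) : ℝ) : ℂ)) := by
      rw [Matrix.diagonal_conjTranspose]
      congr 1
      ext k
      exact Complex.conj_ofReal _
    have hav : (((colMatrix S.av)ᵀ)ᴴ)ᵀ * colMatrix S.av = 1 :=
      colMatrix_conjTranspose_mul_self S.av_orthonormal
    rw [hC, SWBase.ketRho_matrix, Matrix.conjTranspose_mul, Matrix.conjTranspose_mul, hD,
      Matrix.transpose_mul, Matrix.transpose_mul, Matrix.diagonal_transpose]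
    simp only [Matrix.mul_assoc]
    rw [← Matrix.mul_assoc _ (colMatrix S.av), hav, Matrix.one_mul]
  have hb : ∀ f, star S.ketRho ⬝ᵥ S.branch (l, f) = ∑ i, ∑ q, Y (i, f) q *
      ∑ k, star (S.rb k i) * (((Real.sqrt (S.lam k) : ℝ) : ℂ) * star (S.phiMatrix q (k, l))) := by
    intro f
    simp only [dotProduct, Fintype.sum_prod_type (α₁ := Fin d) (α₂ := a), branch, hK]
    refine Finset.sum_congr rfl fun i _ => ?_
    have h1 : ∀ q, ∑ k, star (S.rb k i) *
        (((Real.sqrt (S.lam k) : ℝ) : ℂ) * star (S.phiMatrix q (k, l))) =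
          ((Cᴴ)ᵀ * (colMatrix S.av * (S.phiColumns l)ᴴ)) i q := by
      intro q
      rw [hCP, Matrix.mul_assoc, Matrix.mul_apply]
      simp only [Matrix.diagonal_mul]
      rfl
    simp only [h1]
    simp only [Matrix.mul_apply (M := Y), Matrix.mul_apply (M := (Cᴴ)ᵀ), Finset.mul_sum]
    rw [Finset.sum_comm]
    refine Finset.sum_congr rfl fun q _ => Finset.sum_congr rfl fun x _ => ?_
    simp only [Matrix.transpose_apply, Matrix.conjTranspose_apply, Pi.star_apply, hC,
      Matrix.of_apply]
    ring
  have ha : ∀ k, S.amplitude (k, l) = ∑ f, ∑ i, ∑ q,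
      star (S.eb l f) * (Y (i, f) q * (star (S.rb k i) * star (S.phiMatrix q (k, l)))) := by
    intro k
    rw [amplitude, ← hY, Matrix.mul_assoc, Matrix.mul_apply, Fintype.sum_prod_type,
      Finset.sum_comm]
    refine Finset.sum_congr rfl fun f _ => Finset.sum_congr rfl fun i _ => ?_
    rw [Matrix.mul_apply, Finset.mul_sum]
    refine Finset.sum_congr rfl fun q _ => ?_
    have h3 : S.phiMatrixᴴ (k, l) (i, f) = star (S.rb k i) * star (S.eb l f) := by
      rw [Matrix.conjTranspose_apply, ← star_mul']
      rfl
    rw [h3, Matrix.transpose_apply, Matrix.conjTranspose_apply]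
    ring
  simp only [hb, ha, Finset.mul_sum]
  symm
  rw [Finset.sum_comm]
  refine Finset.sum_congr rfl fun f _ => ?_
  rw [Finset.sum_comm]
  refine Finset.sum_congr rfl fun i _ => ?_
  rw [Finset.sum_comm]
  refine Finset.sum_congr rfl fun q _ => Finset.sum_congr rfl fun k _ => ?_
  ring

/-- In the basis φ the root (σ_R ⊗ σ_E)^{1/2} is diagonal with entries √(λₖ μ_l), so tr(MU) sees
only the diagonal amplitudes, with exactly these weights. -/
theorem sum_sqrt_mul_amplitude :
    ∑ l, ((Real.sqrt (S.mu l) : ℝ) : ℂ) *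
      ∑ k, ((Real.sqrt (S.lam k) : ℝ) : ℂ) * S.amplitude (k, l) = (S.M * S.U).trace := by
  have hUl : S.phiMatrixᴴ * S.phiMatrix = 1 :=
    Matrix.mem_unitaryGroup_iff'.1 S.phiMatrix_mem_unitaryGroup
  have h : (S.M * S.U).trace =
      (diagonal (fun p : Fin d × (a × b) => ((Real.sqrt (S.lam p.1) * Real.sqrt (S.mu p.2) : ℝ)
    : ℂ)) *
        (S.phiMatrixᴴ * (S.ketSigmaZeroMatrix * S.Wᵀ * S.Uᵀ) * (S.phiMatrixᴴ)ᵀ)).trace := by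
    rw [SWBase.M_eq, SWBase.psdPow_sigmaHat_half, ketSigmaZeroMatrix_mul_transpose_W,
      ← Matrix.trace_transpose]
    simp only [Matrix.transpose_mul, Matrix.transpose_transpose, Matrix.mul_assoc]
    rw [← Matrix.mul_assoc S.phiMatrixᴴ S.phiMatrix, hUl, Matrix.one_mul, Matrix.trace_mul_comm,
      Matrix.mul_assoc, Matrix.trace_mul_comm]
    simp only [Matrix.mul_assoc]
  rw [h, Matrix.trace, Fintype.sum_prod_type (α₁ := Fin d)]
  simp only [Finset.mul_sum]
  rw [Finset.sum_comm]
  refine Finset.sum_congr rfl fun k _ => Finset.sum_congr rfl fun l _ => ?_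
  rw [Matrix.diag_apply, Matrix.diagonal_mul, amplitude]
  push_cast
  ring

theorem sq_sum_sv_le_purifiedFidelity :
    (∑ p, S.sv p) ^ 2 ≤ purifiedFidelity S.ketRho (S.decoder ∘ₗ N) := by
  rw [purifiedFidelity_eq_sum_normSq S.idTensor_decoder_eq_sum_branch]
  have h0 : (∑ p, S.sv p) ^ 2 = Complex.normSq (S.M * S.U).trace := by
    rw [trace_M_mul_U, Complex.normSq_ofReal, sq]
  rw [h0, ← sum_sqrt_mul_amplitude, Fintype.sum_prod_type (α₁ := a × b)]
  -- Cauchy–Schwarz is used twice: over l with the unit vector (√μ_l), and for each l over the basis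
  -- of E with the unit vector of conjugated coordinates of e_l.
  refine (normSq_sum_mul_le _ _ ?_).trans (Finset.sum_le_sum fun l _ => ?_)
  · simp only [Complex.normSq_ofReal, Real.mul_self_sqrt (S.mu_nonneg _)]
    exact S.mu_sum
  · rw [← sum_star_eb_mul_branch]
    apply normSq_sum_mul_le
    have h1 := S.eb.orthonormal.1 l
    have h2 := EuclideanSpace.norm_sq_eq (S.eb l)
    rw [h1] at h2
    simp only [Complex.normSq_eq_norm_sq, norm_star]
    rw [← h2, one_pow]

end SWConstruction

end QInfo

theorem theorem1 {a b r : Type*} [Fintype a] [DecidableEq a] [Fintype b] [DecidableEq b]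
    [Fintype r] [DecidableEq r]
    (ρ : Matrix a a ℂ) (hρ : QInfo.IsState ρ)
    (N : Matrix a a ℂ →ₗ[ℂ] Matrix b b ℂ) (hN : QInfo.IsChannel N)
    (D : Matrix b b ℂ →ₗ[ℂ] Matrix a a ℂ) (hD : QInfo.IsSWDecoder ρ N D)
    (ψ : r × a → ℂ) (hψ : QInfo.IsPurification ψ ρ)
    (σ : Matrix (r × b) (r × b) ℂ) (hσ : σ = QInfo.idTensor r N (QInfo.proj ψ)) :
    QInfo.petzMutualInfoDown 2 σ (QInfo.psdPow (QInfo.trSnd σ) (-1)) ≤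
      QInfo.log2 (QInfo.entanglementFidelity ρ (D ∘ₗ N)) := by
  obtain ⟨S, rfl⟩ := hD
  have hblock : σ = QInfo.blockState (QInfo.block ψ S.V) := by
    rw [hσ, QInfo.idTensor_proj_eq_blockState ψ S.V S.stinespring]
  -- The two reference systems may have different dimensions, but Z is the same function of ρ and V
  -- for both purifications.
  have htilt : QInfo.tiltedMarginal σ =
      QInfo.tiltedMarginal (QInfo.blockState (QInfo.block S.ketRho S.V)) := by
    ext y y'
    rw [hblock, QInfo.tiltedMarginal_block_apply hψ S.V_isometry,
      QInfo.tiltedMarginal_block_apply S.isPurification_ketRho S.V_isometry]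
  have hpos : (QInfo.tiltedMarginal σ).PosSemidef := by
    rw [htilt, ← Matrix.posSemidef_transpose_iff, S.tiltedMarginal_transpose]
    exact S.sigmaHat_posSemidef.conjTranspose_mul_mul_same _
  have hstate : QInfo.IsState σ := by
    refine ⟨hblock ▸ QInfo.blockState_posSemidef _, ?_⟩
    have h1 : σ.trace = (QInfo.trSnd σ).trace := by
      simp [Matrix.trace, QInfo.trSnd, Fintype.sum_prod_type]
    rw [h1, hblock, QInfo.trSnd_blockState_block S.V_isometry, Matrix.trace_mul_comm,
      hψ.conjTranspose_mul, Matrix.trace_transpose, hρ.2]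
  refine (QInfo.petzMutualInfoDown_two_le hstate hpos).trans ?_
  have hle : QInfo.sqrtRootSum (QInfo.tiltedMarginal σ).charpoly ^ 2 ≤
      QInfo.entanglementFidelity ρ (S.decoder ∘ₗ N) := by
    rw [htilt, ← S.sum_sv, QInfo.entanglementFidelity_eq hρ.1 S.isPurification_ketRho]
    exact S.sq_sum_sv_le_purifiedFidelity
  unfold QInfo.log2
  by_cases hx : 0 < QInfo.sqrtRootSum (QInfo.tiltedMarginal σ).charpoly ^ 2
  · rw [if_pos hx, if_pos (hx.trans_le hle), EReal.coe_le_coe_iff]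
    exact Real.logb_le_logb_of_le (by norm_num) hx hle
  · rw [if_neg hx]
    exact bot_le
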